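/- All graphs are finite and simple. The grid is the graph on $\mathbb{Z}\times\mathbb{Z}$ in which two points are adjacent when they differ by one in exactly one coordinate. A $B_1$-EPG representation of a graph $G$ assigns to each vertex $v$ a path $P_v$ of the grid with at least one edge and at most one bend (change of direction between horizontal and vertical), such that two distinct vertices $u,v$ are adjacent in $G$ if and only if $P_u$ and $P_v$ share at least one grid edge. $G$ is a $B_1$-EPG graph if it has such a representation, and a Helly-$B_1$-EPG graph if it has a $B_1$-EPG representation in which the family of edge sets of the paths has the Helly property: every nonempty pairwise intersecting subfamily has a common grid edge. $G$ is $\mathcal{F}$-free if it has no induced subgraph isomorphic to a member of $\mathcal{F}$. Let $C_4$ be the cycle on four vertices. Let $S_3$ be the $3$-sun, that is, the graph with vertices $u,v,v',t,t',t''$ in which $u,v,v'$ form a triangle, $\{t,t',t''\}$ is independent, $t$ is adjacent to exactly $v,v'$, $t'$ to exactly $v,u$, and $t''$ to exactly $v',u$. Let $S_{3'}$ be $S_3$ without the edge $t''u$, and let $S_{3''}$ be $S_3$ without the two edges $t'u$ and $t''u$. **Theorem.** Let $G$ be a $B_1$-EPG graph. If $G$ is $\{S_3,S_{3'},S_{3''},C_4\}$-free,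 then $G$ is a Helly-$B_1$-EPG graph. -/

import Mathlib

/-- The infinite rectangular grid: points of `ℤ × ℤ`, joined when they differ by one
in exactly one coordinate. -/
def gridGraph : SimpleGraph (ℤ × ℤ) where
  Adj p q := |p.1 - q.1| + |p.2 - q.2| = 1
  symm := ⟨fun p q h => by rw [abs_sub_comm q.1, abs_sub_comm q.2]; exact h⟩
  loopless := ⟨fun p h => by simp at h⟩

/-- The number of bends of a sequence of grid points. The step into `q` and the step out of `q`,
in consecutive points `p, q, r` of a grid path, have different directions (one is horizontal,
the other is vertical) exactly when `p` and `r` differ in both coordinates. -/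
def bendCount : List (ℤ × ℤ) → ℕ
  | p :: q :: r :: l => (if p.1 ≠ r.1 ∧ p.2 ≠ r.2 then 1 else 0) + bendCount (q :: r :: l)
  | _ => 0

/-- A path of the grid (no repeated points) with at least one edge. -/
structure GridPath where
  start : ℤ × ℤ
  finish : ℤ × ℤ
  walk : gridGraph.Walk start finish
  isPath : walk.IsPath
  one_le_length : 1 ≤ walk.length

/-- The set of grid edges of a grid path. -/
def GridPath.edges (P : GridPath) : Set (Sym2 (ℤ × ℤ)) := {e | e ∈ P.walk.edges}

/-- The number of bends (changes of direction) of a grid path. -/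
def GridPath.bends (P : GridPath) : ℕ := bendCount P.walk.support

/-- `P` is an EPG representation of `G`: two distinct vertices are adjacent iff
the corresponding paths share a grid edge. -/
def IsEPGRep {V : Type*} (G : SimpleGraph V) (P : V → GridPath) : Prop :=
  ∀ u v : V, u ≠ v → (G.Adj u v ↔ ((P u).edges ∩ (P v).edges).Nonempty)

/-- `P` is a `B_k`-EPG representation of `G`: every path has at most `k` bends. -/
def IsBendEPGRep {V : Type*} (k : ℕ) (G : SimpleGraph V) (P : V → GridPath) : Prop :=
  IsEPGRep G P ∧ ∀ v : V, (P v).bends ≤ k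

/-- The Helly property of a family of sets: every (nonempty) pairwise intersecting subfamily
has a common element. -/
def HellyProperty {ι α : Type*} (F : ι → Set α) : Prop :=
  ∀ S : Set ι, S.Nonempty → (∀ i ∈ S, ∀ j ∈ S, (F i ∩ F j).Nonempty) →
    ∃ a : α, ∀ i ∈ S, a ∈ F i

/-- `G` is a `B_k`-EPG graph. -/
def IsBendEPG {V : Type*} (k : ℕ) (G : SimpleGraph V) : Prop :=
  ∃ P : V → GridPath, IsBendEPGRep k G P

/-- `G` is a Helly-`B_k`-EPG graph: it has a `B_k`-EPG representation in which the edge sets of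
the paths have the Helly property. -/
def IsHellyBendEPG {V : Type*} (k : ℕ) (G : SimpleGraph V) : Prop :=
  ∃ P : V → GridPath, IsBendEPGRep k G P ∧ HellyProperty (fun v => (P v).edges)

/-- `G` is `H`-free: it has no induced subgraph isomorphic to `H`. -/
def InducedFree {W V : Type*} (H : SimpleGraph W) (G : SimpleGraph V) : Prop :=
  ¬ H.IsIndContained G

/-- The 3-sun `S_3`: the triangle `0, 1, 2` and the independent set `3, 4, 5`, where `3` is joined
to `1, 2`, `4` is joined to `0, 1` and `5` is joined to `0, 2`. -/
def graphS3 : SimpleGraph (Fin 6) :=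
  SimpleGraph.fromEdgeSet
    {s(0, 1), s(0, 2), s(1, 2), s(3, 1), s(3, 2), s(4, 1), s(5, 2), s(4, 0), s(5, 0)}

/-- `S_{3'}`: the 3-sun without the edge `{5, 0}`. -/
def graphS3' : SimpleGraph (Fin 6) :=
  SimpleGraph.fromEdgeSet
    {s(0, 1), s(0, 2), s(1, 2), s(3, 1), s(3, 2), s(4, 1), s(5, 2), s(4, 0)}

/-- `S_{3''}`: the 3-sun without the edges `{4, 0}` and `{5, 0}`. -/
def graphS3'' : SimpleGraph (Fin 6) :=
  SimpleGraph.fromEdgeSet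
    {s(0, 1), s(0, 2), s(1, 2), s(3, 1), s(3, 2), s(4, 1), s(5, 2)}

/-! A pairwise intersecting family of one-bend paths without a common edge contains a claw: three
paths at a grid point that use left-right, left-up and right-up, possibly after reflecting or
transposing the grid (`common_or_hasSomeClaw`). The rest is Helly's theorem for intervals.

A claw is removed by inserting one new horizontal edge at its point. All left-right and right-up
paths there are made to run through it. Each left-up path gives up one arm: it is straightened along
the row or turned to the right, and so uses the new edge too. The part of the column below the point
goes to one end of the new edge. This creates no adjacency, and loses no common edge if no left-up
path has neighbours outside the claw on both arms (`HasClaw.improvable`).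

If a left-up path is blocked in this way, the mirror image is tried. If a right-up path is blocked
as well, the two paths, a left-right path and suitable neighbours induce one of the three suns
(`Represents.no_exclusive_neighbours`). The remaining obstructions, all involving edges below the
point, give an induced `C_4`.

Each removal strictly enlarges the set of subfamilies with a common edge, so the process ends
without claws (`Represents.exists_no_claw`), hence with the Helly property. -/

/-! ### One-bend paths as sets of unit cells -/

/-- A grid path with at most one bend, as a horizontal interval `[a, b]` of the row `r` and a
vertical interval `[p, q]` of the column `c`. An interval may be empty; if neither is, then they
meet in a common end. -/
@[ext] structure Ell where
  r : ℤ
  a : ℤ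
  b : ℤ
  c : ℤ
  p : ℤ
  q : ℤ
  nonempty : a < b ∨ p < q
  corner : a < b → p < q → (c = a ∨ c = b) ∧ (r = p ∨ r = q)

namespace Ell

/-- The unit cells of an `Ell`: `inl (i, j)` is the edge from `(i, j)` to `(i + 1, j)` and
`inr (i, j)` is the edge from `(i, j)` to `(i, j + 1)`. -/
def cells (P : Ell) : Set ((ℤ × ℤ) ⊕ (ℤ × ℤ)) :=
  {e | Sum.elim (fun x => P.r = x.2 ∧ P.a ≤ x.1 ∧ x.1 < P.b)
    (fun x => P.c = x.1 ∧ P.p ≤ x.2 ∧ x.2 < P.q) e}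

@[simp] lemma mem_cells_inl (P : Ell) (i j : ℤ) :
    (Sum.inl (i, j) : (ℤ × ℤ) ⊕ (ℤ × ℤ)) ∈ P.cells ↔ P.r = j ∧ P.a ≤ i ∧ i < P.b := Iff.rfl

@[simp] lemma mem_cells_inr (P : Ell) (i j : ℤ) :
    (Sum.inr (i, j) : (ℤ × ℤ) ⊕ (ℤ × ℤ)) ∈ P.cells ↔ P.c = i ∧ P.p ≤ j ∧ j < P.q := Iff.rfl

/-- Some horizontal cell is shared. -/
def HMeet (P Q : Ell) : Prop := P.r = Q.r ∧ P.a < P.b ∧ Q.a < Q.b ∧ P.a < Q.b ∧ Q.a < P.b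

/-- Some vertical cell is shared. -/
def VMeet (P Q : Ell) : Prop := P.c = Q.c ∧ P.p < P.q ∧ Q.p < Q.q ∧ P.p < Q.q ∧ Q.p < P.q

/-- Some cell is shared. -/
def Meet (P Q : Ell) : Prop := P.HMeet Q ∨ P.VMeet Q

lemma inter_nonempty_iff (P Q : Ell) : (P.cells ∩ Q.cells).Nonempty ↔ P.Meet Q := by
  constructor
  · rintro ⟨⟨i, j⟩ | ⟨i, j⟩, h1, h2⟩
    · simp only [mem_cells_inl] at h1 h2
      left; unfold HMeet; omega
    · simp only [mem_cells_inr] at h1 h2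
      right; unfold VMeet; omega
  · rintro (h | h) <;> simp only [HMeet, VMeet] at h
    · rcases le_total P.a Q.a with h' | h'
      · exact ⟨.inl (Q.a, P.r), by rw [mem_cells_inl]; omega, by rw [mem_cells_inl]; omega⟩
      · exact ⟨.inl (P.a, P.r), by rw [mem_cells_inl]; omega, by rw [mem_cells_inl]; omega⟩
    · rcases le_total P.p Q.p with h' | h'
      · exact ⟨.inr (P.c, Q.p), by rw [mem_cells_inr]; omega, by rw [mem_cells_inr]; omega⟩
      · exact ⟨.inr (P.c, P.p), by rw [mem_cells_inr]; omega, by rw [mem_cells_inr]; omega⟩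

/-- The path uses the edge to the left of `(x, y)`. -/
def HasL (P : Ell) (x y : ℤ) : Prop := P.r = y ∧ P.a < x ∧ x ≤ P.b
/-- The path uses the edge to the right of `(x, y)`. -/
def HasR (P : Ell) (x y : ℤ) : Prop := P.r = y ∧ P.a ≤ x ∧ x < P.b
/-- The path uses the edge above `(x, y)`. -/
def HasU (P : Ell) (x y : ℤ) : Prop := P.c = x ∧ P.p ≤ y ∧ y < P.q
/-- The path uses the edge below `(x, y)`. -/
def HasD (P : Ell) (x y : ℤ) : Prop := P.c = x ∧ P.p < y ∧ y ≤ P.q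

/-! ### Symmetries of the grid -/

/-- Reflection in the vertical axis. -/
def reflectX (P : Ell) : Ell where
  r := P.r
  a := -P.b
  b := -P.a
  c := -P.c
  p := P.p
  q := P.q
  nonempty := by have := P.nonempty; omega
  corner := by have := P.corner; omega

/-- Reflection in the horizontal axis. -/
def reflectY (P : Ell) : Ell where
  r := -P.r
  a := P.a
  b := P.b
  c := P.c
  p := -P.q
  q := -P.p
  nonempty := by have := P.nonempty; omega
  corner := by have := P.corner; omega

/-- Reflection in the diagonal. -/
def transpose (P : Ell) : Ell where
  r := P.c
  a := P.p
  b := P.q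
  c := P.r
  p := P.a
  q := P.b
  nonempty := by have := P.nonempty; omega
  corner := by have := P.corner; omega

/-! ### Splitting a column and rearranging the paths at a claw -/

/-- The column of the vertical part after the column `X` has been split at row `y`: the part above
`y` stays, the part below `y` is moved by `d`. -/
def splitCol (X y d : ℤ) (P : Ell) : ℤ :=
  if P.c < X then P.c else if X < P.c then P.c + 1 else if y ≤ P.p then X else X + d

/-- The left end of the horizontal part after splitting the column `X` at row `y`. -/
def splitLeft (X y d : ℤ) (P : Ell) : ℤ :=
  if P.a < X then P.a else if X < P.a then P.a + 1 else
    if P.p < P.q ∧ P.c = X then P.splitCol X y d else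
      if y < P.r then X else if P.r < y then X + d else X + 1

/-- The right end of the horizontal part after splitting the column `X` at row `y`. -/
def splitRight (X y d : ℤ) (P : Ell) : ℤ :=
  if P.b < X then P.b else if X < P.b then P.b + 1 else
    if P.p < P.q ∧ P.c = X then P.splitCol X y d else
      if y < P.r then X else if P.r < y then X + d else X

lemma split_nonempty {X y d : ℤ} {P : Ell} (hd : d = 0 ∨ d = 1) :
    P.splitLeft X y d < P.splitRight X y d ∨ P.p < P.q := by
  have h1 := P.nonempty
  by_cases h : P.p < P.q
  · exact Or.inr h
  · left
    unfold splitLeft splitRight splitCol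
    split_ifs <;> omega

lemma split_corner {X y d : ℤ} {P : Ell} (hd : d = 0 ∨ d = 1) :
    P.splitLeft X y d < P.splitRight X y d → P.p < P.q →
      (P.splitCol X y d = P.splitLeft X y d ∨ P.splitCol X y d = P.splitRight X y d) ∧
        (P.r = P.p ∨ P.r = P.q) := by
  have h2 := P.corner
  intro h h'
  have hab : P.a < P.b := by
    revert h
    unfold splitLeft splitRight splitCol
    split_ifs <;> omega
  obtain ⟨h3, h4⟩ := h2 hab h'
  refine ⟨?_, h4⟩
  rcases h3 with h3 | h3
  · left
    unfold splitLeft splitCol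
    split_ifs <;> omega
  · right
    unfold splitRight splitCol
    split_ifs <;> omega

/-- The path after splitting the column `X` at row `y`. -/
def split (X y d : ℤ) (hd : d = 0 ∨ d = 1) (P : Ell) : Ell where
  r := P.r
  a := P.splitLeft X y d
  b := P.splitRight X y d
  c := P.splitCol X y d
  p := P.p
  q := P.q
  nonempty := split_nonempty hd
  corner := split_corner hd

/-- The horizontal path from `a` to `b` in row `y`. -/
def horizontal (y a b : ℤ) (h : a < b) : Ell where
  r := y
  a := a
  b := b
  c := a
  p := y
  q := y
  nonempty := Or.inl h
  corner := by omega

/-- The path with a bend at `(X, y)`, one step to the right, and up to height `q`. -/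
def rightUp (X y q : ℤ) : Ell where
  r := y
  a := X
  b := X + 1
  c := X
  p := y
  q := q
  nonempty := by omega
  corner := by omega

open Classical in
/-- The rearrangement at `(X, y)`: paths bending there from left to up are straightened when `long`
holds and turned to the right otherwise, and the column `X` is split. -/
noncomputable def surgery (X y d : ℤ) (hd : d = 0 ∨ d = 1) (long : Prop) (P : Ell) : Ell :=
  if h : P.HasL X y ∧ P.HasU X y then
    if long then horizontal y P.a (X + 1) (by unfold HasL at h; omega) else rightUp X y P.q
  else P.split X y d hd

/-- The old cell at the place of a cell of the split grid. -/
def oldCell (X y d : ℤ) : (ℤ × ℤ) ⊕ (ℤ × ℤ) → (ℤ × ℤ) ⊕ (ℤ × ℤ)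
  | .inl (i, j) => if i < X then .inl (i, j) else if X < i then .inl (i - 1, j) else
      if y < j then .inl (i, j) else .inl (i - d, j)
  | .inr (i, j) => if i ≤ X then .inr (i, j) else .inr (i - 1, j)

/-- A cell of the split grid that comes from a given cell. -/
def newCell (X y d : ℤ) : (ℤ × ℤ) ⊕ (ℤ × ℤ) → (ℤ × ℤ) ⊕ (ℤ × ℤ)
  | .inl (i, j) => if i < X then .inl (i, j) else .inl (i + 1, j)
  | .inr (i, j) => if i < X then .inr (i, j) else if X < i then .inr (i + 1, j) else
      if y ≤ j then .inr (i, j) else .inr (i + d, j)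

lemma oldCell_inl (X y d i j : ℤ) : oldCell X y d (.inl (i, j)) =
    if i < X then .inl (i, j) else if X < i then .inl (i - 1, j) else
      if y < j then .inl (i, j) else .inl (i - d, j) := rfl

lemma oldCell_inr (X y d i j : ℤ) : oldCell X y d (.inr (i, j)) =
    if i ≤ X then .inr (i, j) else .inr (i - 1, j) := rfl

lemma newCell_inl (X y d i j : ℤ) : newCell X y d (.inl (i, j)) =
    if i < X then .inl (i, j) else .inl (i + 1, j) := rfl

lemma newCell_inr (X y d i j : ℤ) : newCell X y d (.inr (i, j)) =
    if i < X then .inr (i, j) else if X < i then .inr (i + 1, j) else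
      if y ≤ j then .inr (i, j) else .inr (i + d, j) := rfl

/-- Two of the three edges at `(X, y)` that are not below it are used. -/
def InClaw (X y : ℤ) (P : Ell) : Prop :=
  (P.HasL X y ∧ P.HasR X y) ∨ (P.HasL X y ∧ P.HasU X y) ∨ (P.HasR X y ∧ P.HasU X y)

section
variable {X y d : ℤ} {hd : d = 0 ∨ d = 1} {long : Prop} {P : Ell}

/-- For `d = 1` a path straight down the column through `(X, y)` would be shifted as a whole, and a
left arm above row `y` would gain a cell with no counterpart; `h1` excludes such paths. -/
lemma split_inl_of_mem (h1 : d = 1 → ¬ (P.HasU X y ∧ P.HasD X y)) {i j : ℤ}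
    (h : Sum.inl (i, j) ∈ (P.split X y d hd).cells) (hne : (i, j) ≠ (X, y)) :
    oldCell X y d (.inl (i, j)) ∈ P.cells := by
  simp only [mem_cells_inl, split] at h
  have h2 := P.corner
  have hne' : ¬ (i = X ∧ j = y) := fun h => hne (by rw [h.1, h.2])
  unfold HasU HasD at h1
  obtain ⟨rfl, ha, hb⟩ := h
  have hab : P.a < P.b := by
    revert ha hb
    unfold splitLeft splitRight splitCol
    split_ifs <;> omega
  revert ha hb
  rw [oldCell_inl]
  unfold splitLeft splitRight splitCol
  split_ifs <;> rw [mem_cells_inl] <;> omega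

lemma split_inr_of_mem {i j : ℤ} (h : Sum.inr (i, j) ∈ (P.split X y d hd).cells) :
    oldCell X y d (.inr (i, j)) ∈ P.cells := by
  simp only [mem_cells_inr, split, splitCol] at h
  rw [oldCell_inr]
  revert h
  split_ifs <;> rw [mem_cells_inr] <;> omega

/-- Upward bends at `(X, y)` stay at `X`, so right-up paths gain the inserted cell. Downward bends
land at `X + d`: right-down paths would gain it for `d = 0`, left-down paths for `d = 1`. -/
lemma inl_mem_split_iff (hB : ¬ (P.HasL X y ∧ P.HasU X y))
    (hF : d = 0 → ¬ (P.HasR X y ∧ P.HasD X y)) (hF' : d = 1 → ¬ (P.HasL X y ∧ P.HasD X y)) :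
    Sum.inl (X, y) ∈ (P.split X y d hd).cells ↔ InClaw X y P := by
  simp only [mem_cells_inl, split]
  have h2 := P.corner
  unfold HasL HasU at hB
  unfold HasR HasD at hF
  unfold HasL HasD at hF'
  unfold InClaw HasL HasR HasU splitLeft splitRight splitCol
  constructor
  · split_ifs <;> omega
  · rintro (h | h | h)
    · split_ifs <;> omega
    · exact absurd h hB
    · split_ifs <;> omega

lemma newCell_mem_split (h1 : d = 1 → ¬ (P.HasU X y ∧ P.HasD X y))
    {e : (ℤ × ℤ) ⊕ (ℤ × ℤ)} (h : e ∈ P.cells) : newCell X y d e ∈ (P.split X y d hd).cells := by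
  have h2 := P.corner
  unfold HasU HasD at h1
  rcases e with ⟨i, j⟩ | ⟨i, j⟩
  · simp only [mem_cells_inl] at h
    rw [newCell_inl]
    split_ifs <;> simp only [mem_cells_inl, split] <;>
      unfold splitLeft splitRight splitCol <;> split_ifs <;> omega
  · simp only [mem_cells_inr] at h
    rw [newCell_inr]
    split_ifs <;> simp only [mem_cells_inr, split] <;>
      unfold splitCol <;> split_ifs <;> omega

/-- Shows that no adjacency is created: a shared cell other than the inserted one comes from a
shared old cell. -/
lemma oldCell_mem_of_mem_surgery (h1 : d = 1 → ¬ (P.HasU X y ∧ P.HasD X y))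
    {e : (ℤ × ℤ) ⊕ (ℤ × ℤ)} (h : e ∈ (P.surgery X y d hd long).cells) (he : e ≠ .inl (X, y)) :
    oldCell X y d e ∈ P.cells := by
  unfold surgery at h
  split_ifs at h with hB hl
  · have h3 := P.corner
    unfold HasL HasU at hB
    rcases e with ⟨i, j⟩ | ⟨i, j⟩
    · have hne' : ¬ (i = X ∧ j = y) := fun h => he (by rw [h.1, h.2])
      simp only [mem_cells_inl, horizontal] at h
      rw [oldCell_inl]
      split_ifs <;> rw [mem_cells_inl] <;> omega
    · simp only [mem_cells_inr, horizontal] at h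
      omega
  · have h3 := P.corner
    unfold HasL HasU at hB
    rcases e with ⟨i, j⟩ | ⟨i, j⟩
    · have hne' : ¬ (i = X ∧ j = y) := fun h => he (by rw [h.1, h.2])
      simp only [mem_cells_inl, rightUp] at h
      omega
    · simp only [mem_cells_inr, rightUp] at h
      rw [oldCell_inr]
      split_ifs <;> rw [mem_cells_inr] <;> omega
  · rcases e with ⟨i, j⟩ | ⟨i, j⟩
    · exact split_inl_of_mem h1 h (fun h' => he (by rw [h']))
    · exact split_inr_of_mem h

lemma inl_mem_surgery_iff (hF : d = 0 → ¬ (P.HasR X y ∧ P.HasD X y))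
    (hF' : d = 1 → ¬ (P.HasL X y ∧ P.HasD X y)) :
    Sum.inl (X, y) ∈ (P.surgery X y d hd long).cells ↔ InClaw X y P := by
  unfold surgery
  split_ifs with hB hl
  · refine iff_of_true ?_ (Or.inr (Or.inl hB))
    unfold HasL HasU at hB
    exact ⟨rfl, hB.1.2.1.le, Int.lt_succ X⟩
  · refine iff_of_true ?_ (Or.inr (Or.inl hB))
    simp [rightUp]
  · exact inl_mem_split_iff hB hF hF'

/-- A left-up path keeps only one arm, the horizontal one exactly when `long` holds; `h2` says that
`e` is not on the lost arm. -/
lemma newCell_mem_surgery (h1 : d = 1 → ¬ (P.HasU X y ∧ P.HasD X y))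
    {e : (ℤ × ℤ) ⊕ (ℤ × ℤ)} (h : e ∈ P.cells)
    (h2 : P.HasL X y ∧ P.HasU X y → (long ↔ e.isLeft)) :
    newCell X y d e ∈ (P.surgery X y d hd long).cells := by
  unfold surgery
  split_ifs with hB hl
  · have h3 := P.corner
    unfold HasL HasU at hB
    rcases e with ⟨i, j⟩ | ⟨i, j⟩
    · simp only [mem_cells_inl] at h
      rw [newCell_inl]
      split_ifs <;> simp only [mem_cells_inl, horizontal] <;> omega
    · exact absurd ((h2 hB).1 hl) (by simp)
  · have h3 := P.corner
    unfold HasL HasU at hB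
    rcases e with ⟨i, j⟩ | ⟨i, j⟩
    · exact absurd ((h2 hB).2 (by simp)) hl
    · simp only [mem_cells_inr] at h
      rw [newCell_inr]
      split_ifs <;> simp only [mem_cells_inr, rightUp] <;> omega
  · exact newCell_mem_split h1 h

end

end Ell

/-! ### Which paths near a grid point can meet -/

namespace Ell

section
variable {P Q : Ell} {x y : ℤ}

lemma HMeet.symm (h : P.HMeet Q) : Q.HMeet P := by unfold HMeet at *; omega
lemma VMeet.symm (h : P.VMeet Q) : Q.VMeet P := by unfold VMeet at *; omega
lemma Meet.symm (h : P.Meet Q) : Q.Meet P := h.imp HMeet.symm VMeet.symm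

lemma hMeet_of_hasL (hP : P.HasL x y) (hQ : Q.HasL x y) : P.HMeet Q := by
  unfold HasL HMeet at *; omega
lemma hMeet_of_hasR (hP : P.HasR x y) (hQ : Q.HasR x y) : P.HMeet Q := by
  unfold HasR HMeet at *; omega
lemma vMeet_of_hasU (hP : P.HasU x y) (hQ : Q.HasU x y) : P.VMeet Q := by
  unfold HasU VMeet at *; omega
lemma vMeet_of_hasD (hP : P.HasD x y) (hQ : Q.HasD x y) : P.VMeet Q := by
  unfold HasD VMeet at *; omega

lemma not_hasL_hasR_vertical (hL : P.HasL x y) (hR : P.HasR x y) :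
    ¬ P.HasU x y ∧ ¬ P.HasD x y := by
  have := P.corner
  unfold HasL HasR HasU HasD at *; omega

lemma not_hasU_hasD_horizontal (hU : P.HasU x y) (hD : P.HasD x y) :
    ¬ P.HasL x y ∧ ¬ P.HasR x y := by
  have := P.corner
  unfold HasL HasR HasU HasD at *; omega

/-- A path straight through `(x, y)` can bend only elsewhere: a vertical arm of `P` is off the
column `x`, and a horizontal arm of `Q` is off the row `y`. -/
lemma not_meet_straight (hP : P.HasL x y ∧ P.HasR x y) (hQ : Q.HasU x y ∧ Q.HasD x y) :
    ¬ P.Meet Q := by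
  have h1 := P.corner
  have h2 := Q.corner
  unfold Meet HMeet VMeet HasL HasR HasU HasD at *; omega

lemma not_meet_LU_RD (hP : P.HasL x y ∧ P.HasU x y) (hQ : Q.HasR x y ∧ Q.HasD x y) :
    ¬ P.Meet Q := by
  have h1 := P.corner
  have h2 := Q.corner
  unfold Meet HMeet VMeet HasL HasR HasU HasD at *; omega

lemma not_meet_RU_LD (hP : P.HasR x y ∧ P.HasU x y) (hQ : Q.HasL x y ∧ Q.HasD x y) :
    ¬ P.Meet Q := by
  have h1 := P.corner
  have h2 := Q.corner
  unfold Meet HMeet VMeet HasL HasR HasU HasD at *; omega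

/-- `Q` reaches above row `y` in column `x`, so a horizontal arm in row `y` would make it bend
upwards at `(x, y)`, which is excluded. -/
lemma not_meet_upper {B : Ell} (hB : (B.HasL x y ∨ B.HasR x y) ∧ B.HasU x y)
    (hP : P.HasL x y ∧ P.HasR x y) (hQ : B.VMeet Q) (h1 : ¬ (Q.HasL x y ∧ Q.HasU x y))
    (h2 : ¬ (Q.HasR x y ∧ Q.HasU x y)) : ¬ Q.Meet P := by
  have h3 := P.corner
  have h4 := Q.corner
  have h5 := B.corner
  unfold Meet HMeet VMeet HasL HasR HasU at *; omega

/-- `Q` stays weakly left of `x` in row `y`, and if it bends at `(x, y)` it turns down, away from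
both arms of `C`. -/
lemma not_meet_left {B C : Ell} (hB : B.HasL x y ∧ B.HasU x y) (hC : C.HasR x y ∧ C.HasU x y)
    (hQ : B.HMeet Q) (h1 : ¬ (Q.HasL x y ∧ Q.HasR x y)) (h2 : ¬ (Q.HasL x y ∧ Q.HasU x y)) :
    ¬ Q.Meet C := by
  have h3 := C.corner
  have h4 := Q.corner
  have h5 := B.corner
  unfold Meet HMeet VMeet HasL HasR HasU at *; omega

lemma not_meet_right {B C : Ell} (hB : B.HasL x y ∧ B.HasU x y) (hC : C.HasR x y ∧ C.HasU x y)
    (hQ : C.HMeet Q) (h1 : ¬ (Q.HasL x y ∧ Q.HasR x y)) (h2 : ¬ (Q.HasR x y ∧ Q.HasU x y)) :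
    ¬ Q.Meet B := by
  have h3 := C.corner
  have h4 := Q.corner
  have h5 := B.corner
  unfold Meet HMeet VMeet HasL HasR HasU at *; omega

/-- `T` has no horizontal arm in row `y`, so it could meet `Q` only in column `x`. There `Q` bends
from left to down, and `T` would run straight through; this is what `h5` excludes. -/
lemma not_meet_upper_left {B T : Ell} (hB : B.HasL x y ∧ B.HasU x y) (hQ : B.HMeet Q)
    (h2 : ¬ (Q.HasL x y ∧ Q.HasU x y))
    (hT : B.VMeet T) (h3 : ¬ (T.HasL x y ∧ T.HasU x y)) (h4 : ¬ (T.HasR x y ∧ T.HasU x y))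
    (h5 : ¬ ((T.HasU x y ∧ T.HasD x y) ∧ (Q.HasL x y ∧ Q.HasD x y))) : ¬ T.Meet Q := by
  have h6 := T.corner
  have h7 := Q.corner
  have h8 := B.corner
  unfold Meet HMeet VMeet HasL HasR HasU HasD at *; omega

lemma not_meet_upper_right {C T : Ell} (hC : C.HasR x y ∧ C.HasU x y) (hQ : C.HMeet Q)
    (h2 : ¬ (Q.HasR x y ∧ Q.HasU x y))
    (hT : C.VMeet T) (h3 : ¬ (T.HasL x y ∧ T.HasU x y)) (h4 : ¬ (T.HasR x y ∧ T.HasU x y))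
    (h5 : ¬ ((T.HasU x y ∧ T.HasD x y) ∧ (Q.HasR x y ∧ Q.HasD x y))) : ¬ T.Meet Q := by
  have h6 := T.corner
  have h7 := Q.corner
  have h8 := C.corner
  unfold Meet HMeet VMeet HasL HasR HasU HasD at *; omega

/-- The paths lie on opposite sides of `x` in row `y`, so they could meet only vertically after
bending at `(x, y)`. The bend is downward because `Q` does not turn up. -/
lemma not_meet_left_right {B C : Ell} (hB : B.HasL x y ∧ B.HasU x y)
    (hC : C.HasR x y ∧ C.HasU x y) (hP : B.HMeet P) (hQ : C.HMeet Q)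
    (h1 : ¬ (P.HasL x y ∧ P.HasR x y))
    (h3 : ¬ (Q.HasL x y ∧ Q.HasR x y)) (h4 : ¬ (Q.HasR x y ∧ Q.HasU x y))
    (h5 : ¬ ((P.HasL x y ∧ P.HasD x y) ∧ (Q.HasR x y ∧ Q.HasD x y))) : ¬ P.Meet Q := by
  have h6 := P.corner
  have h7 := Q.corner
  have hP' : P.r = y ∧ P.a < x ∧ P.b ≤ x ∧ P.a < P.b := by
    have := B.corner
    clear hQ h3 h4 h5 h6 h7 hC
    unfold HMeet HasL HasR HasU at *; omega
  have hQ' : Q.r = y ∧ x < Q.b ∧ x ≤ Q.a ∧ Q.a < Q.b := by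
    have := C.corner
    clear hP h1 h4 h5 h6 h7 hB hP'
    unfold HMeet HasL HasR HasU at *; omega
  clear hB hC hP hQ h1 h3
  rintro (h | h)
  · unfold HMeet at h; omega
  · unfold VMeet at h
    have h6' := h6 hP'.2.2.2 h.2.1
    have h7' := h7 hQ'.2.2.2 h.2.2.1
    have hx : P.c = x ∧ Q.c = x := by omega
    have hD : P.q = y ∧ Q.q = y := by
      clear h5
      unfold HasR HasU at h4
      omega
    unfold HasL HasR HasD at h5
    omega

/-- Of two paths that meet the upper arms of `B` and `C`, one meets both. -/
lemma exists_vMeet_both {B C T T' : Ell} (hB : B.HasU x y) (hC : C.HasU x y) (hBp : B.p = y)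
    (hCp : C.p = y) (h1 : B.VMeet T) (h2 : C.VMeet T') :
    (B.VMeet T ∧ C.VMeet T) ∨ (B.VMeet T' ∧ C.VMeet T') := by
  unfold VMeet HasU at *; omega

lemma p_eq_of_bend (h1 : P.HasL x y ∨ P.HasR x y) (h2 : P.HasU x y) : P.p = y := by
  have := P.corner
  unfold HasL HasR HasU at *; omega

end

/-! ### Families of paths and the removal of a claw -/

section family
variable {V : Type*}

/-- Some cell lies on all the paths with index in `S`. -/
def Common (R : V → Ell) (S : Set V) : Prop := ∃ e, ∀ v ∈ S, e ∈ (R v).cells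

/-- Distinct vertices are adjacent iff their paths share a cell. -/
def Represents (R : V → Ell) (G : SimpleGraph V) : Prop :=
  ∀ u v, u ≠ v → (G.Adj u v ↔ (R u).Meet (R v))

/-- Expresses adjacency through `Common`, so that invariance of `Common` under symmetries transfers
representations. -/
lemma common_pair_iff (R : V → Ell) (u v : V) : Common R {u, v} ↔ (R u).Meet (R v) := by
  rw [← inter_nonempty_iff]
  simp [Common, Set.Nonempty]

lemma common_reflectX (R : V → Ell) (S : Set V) :
    Common (fun v => (R v).reflectX) S ↔ Common R S := by
  constructor
  · rintro ⟨⟨i, j⟩ | ⟨i, j⟩, h⟩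
    · refine ⟨.inl (-1 - i, j), fun v hv => ?_⟩
      have := h v hv
      simp only [mem_cells_inl, reflectX] at this ⊢; omega
    · refine ⟨.inr (-i, j), fun v hv => ?_⟩
      have := h v hv
      simp only [mem_cells_inr, reflectX] at this ⊢; omega
  · rintro ⟨⟨i, j⟩ | ⟨i, j⟩, h⟩
    · refine ⟨.inl (-1 - i, j), fun v hv => ?_⟩
      have := h v hv
      simp only [mem_cells_inl, reflectX] at this ⊢; omega
    · refine ⟨.inr (-i, j), fun v hv => ?_⟩
      have := h v hv
      simp only [mem_cells_inr, reflectX] at this ⊢; omega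

lemma common_reflectY (R : V → Ell) (S : Set V) :
    Common (fun v => (R v).reflectY) S ↔ Common R S := by
  constructor
  · rintro ⟨⟨i, j⟩ | ⟨i, j⟩, h⟩
    · refine ⟨.inl (i, -j), fun v hv => ?_⟩
      have := h v hv
      simp only [mem_cells_inl, reflectY] at this ⊢; omega
    · refine ⟨.inr (i, -1 - j), fun v hv => ?_⟩
      have := h v hv
      simp only [mem_cells_inr, reflectY] at this ⊢; omega
  · rintro ⟨⟨i, j⟩ | ⟨i, j⟩, h⟩
    · refine ⟨.inl (i, -j), fun v hv => ?_⟩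
      have := h v hv
      simp only [mem_cells_inl, reflectY] at this ⊢; omega
    · refine ⟨.inr (i, -1 - j), fun v hv => ?_⟩
      have := h v hv
      simp only [mem_cells_inr, reflectY] at this ⊢; omega

lemma common_transpose (R : V → Ell) (S : Set V) :
    Common (fun v => (R v).transpose) S ↔ Common R S := by
  constructor
  · rintro ⟨⟨i, j⟩ | ⟨i, j⟩, h⟩
    · exact ⟨.inr (j, i), fun v hv => h v hv⟩
    · exact ⟨.inl (j, i), fun v hv => h v hv⟩
  · rintro ⟨⟨i, j⟩ | ⟨i, j⟩, h⟩
    · exact ⟨.inr (j, i), fun v hv => h v hv⟩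
    · exact ⟨.inl (j, i), fun v hv => h v hv⟩

/-- Some other family has the same pairwise intersections, and strictly more subfamilies with a
common cell. -/
def Improvable (R : V → Ell) : Prop :=
  ∃ R' : V → Ell, (∀ S, Common R S → Common R' S) ∧
    (∀ u v, Common R' {u, v} → Common R {u, v}) ∧ ∃ S, Common R' S ∧ ¬ Common R S

lemma Improvable.of_common_iff {R R₁ : V → Ell} (h : ∀ S, Common R₁ S ↔ Common R S)
    (hR : Improvable R₁) : Improvable R := by
  obtain ⟨R', h1, h2, S, h3, h4⟩ := hR
  exact ⟨R', fun S hS => h1 S ((h S).2 hS), fun u v huv => (h _).1 (h2 u v huv), S, h3,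
    fun hS => h4 ((h S).2 hS)⟩

lemma Represents.of_common_iff {R R₁ : V → Ell} {G : SimpleGraph V}
    (h : ∀ S, Common R₁ S ↔ Common R S) (hR : Represents R G) : Represents R₁ G := by
  intro u v huv
  rw [hR u v huv, ← common_pair_iff, ← common_pair_iff, h]

/-- Three paths at `(x, y)`, each using two of the three edges that are not below `(x, y)`. -/
def HasClaw (R : V → Ell) (x y : ℤ) : Prop :=
  (∃ v, (R v).HasL x y ∧ (R v).HasR x y) ∧ (∃ v, (R v).HasL x y ∧ (R v).HasU x y) ∧
    ∃ v, (R v).HasR x y ∧ (R v).HasU x y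

/-- Two two-element subsets of a three-element set intersect. -/
lemma InClaw.meet {P Q : Ell} {x y : ℤ} (hP : P.InClaw x y) (hQ : Q.InClaw x y) : P.Meet Q := by
  have h1 : P.HasL x y → Q.HasL x y → P.Meet Q := fun h h' => Or.inl (hMeet_of_hasL h h')
  have h2 : P.HasR x y → Q.HasR x y → P.Meet Q := fun h h' => Or.inl (hMeet_of_hasR h h')
  have h3 : P.HasU x y → Q.HasU x y → P.Meet Q := fun h h' => Or.inr (vMeet_of_hasU h h')
  rcases hP with ⟨p1, p2⟩ | ⟨p1, p2⟩ | ⟨p1, p2⟩ <;>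
    rcases hQ with ⟨q1, q2⟩ | ⟨q1, q2⟩ | ⟨q1, q2⟩ <;>
    first
      | exact h1 ‹_› ‹_›
      | exact h2 ‹_› ‹_›
      | exact h3 ‹_› ‹_›

/-- A common cell cannot be horizontal, since the left-up and right-up paths lie on opposite sides
of `x`, nor vertical, since the left-right path has no cell in column `x`. -/
lemma HasClaw.not_common {R : V → Ell} {x y : ℤ} (h : HasClaw R x y) :
    ¬ Common R {v | (R v).InClaw x y} := by
  obtain ⟨⟨a, ha⟩, ⟨b, hb⟩, ⟨c, hc⟩⟩ := h
  rintro ⟨e, he⟩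
  have h1 := he a (Or.inl ha)
  have h2 := he b (Or.inr (Or.inl hb))
  have h3 := he c (Or.inr (Or.inr hc))
  have h4 := (R a).corner
  have h5 := (R b).corner
  have h6 := (R c).corner
  unfold HasL HasR at ha
  unfold HasL HasU at hb
  unfold HasR HasU at hc
  rcases e with ⟨i, j⟩ | ⟨i, j⟩
  · simp only [mem_cells_inl] at h1 h2 h3; omega
  · simp only [mem_cells_inr] at h1 h2 h3; omega

/-- Removal of a claw in which no path bending from left to up has both a exclusive neighbour on the
left and one above. -/
lemma HasClaw.improvable {R : V → Ell} {X y : ℤ} (h : HasClaw R X y)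
    (hEF : ¬ ((∃ v, (R v).HasU X y ∧ (R v).HasD X y) ∧ ∃ v, (R v).HasR X y ∧ (R v).HasD X y))
    (hFF : ¬ ((∃ v, (R v).HasL X y ∧ (R v).HasD X y) ∧ ∃ v, (R v).HasR X y ∧ (R v).HasD X y))
    (hlong : ∀ b, (R b).HasL X y ∧ (R b).HasU X y →
      (∃ l, (R b).HMeet (R l) ∧ ¬ ((R l).HasL X y ∧ (R l).HasR X y) ∧
        ¬ ((R l).HasL X y ∧ (R l).HasU X y)) →
      ∀ t, (R b).VMeet (R t) → ((R t).HasL X y ∧ (R t).HasU X y) ∨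
        ((R t).HasR X y ∧ (R t).HasU X y)) : Improvable R := by
  classical
  -- A right-down path forces `d = 1`; then `hEF` and `hFF` exclude the paths harmed by that shift.
  -- Otherwise `d = 0` works.
  obtain ⟨d, hd, hd0, hd1, hd2⟩ : ∃ d : ℤ, (d = 0 ∨ d = 1) ∧
      (d = 0 → ∀ v, ¬ ((R v).HasR X y ∧ (R v).HasD X y)) ∧
      (d = 1 → ∀ v, ¬ ((R v).HasU X y ∧ (R v).HasD X y)) ∧
      (d = 1 → ∀ v, ¬ ((R v).HasL X y ∧ (R v).HasD X y)) := by
    by_cases hF : ∃ v, (R v).HasR X y ∧ (R v).HasD X y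
    · exact ⟨1, Or.inr rfl, fun h => absurd h (by decide), fun _ v hv => hEF ⟨⟨v, hv⟩, hF⟩,
        fun _ v hv => hFF ⟨⟨v, hv⟩, hF⟩⟩
    · exact ⟨0, Or.inl rfl, fun _ v hv => hF ⟨v, hv⟩, fun h => absurd h (by decide),
        fun h => absurd h (by decide)⟩
  -- A left-up path keeps its left arm exactly when it has a neighbour there outside the left-right
  -- and left-up paths.
  let long (b : V) : Prop := ∃ l, (R b).HMeet (R l) ∧ ¬ ((R l).HasL X y ∧ (R l).HasR X y) ∧
        ¬ ((R l).HasL X y ∧ (R l).HasU X y)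
  let R' : V → Ell := fun v => (R v).surgery X y d hd (long v)
  have hmem (v : V) : Sum.inl (X, y) ∈ (R' v).cells ↔ (R v).InClaw X y :=
    inl_mem_surgery_iff (fun h => hd0 h v) (fun h => hd2 h v)
  have hclaw : Common R' {v | (R v).InClaw X y} := ⟨_, fun v hv => (hmem v).2 hv⟩
  refine ⟨R', ?_, ?_, _, hclaw, h.not_common⟩
  · rintro S ⟨e, he⟩
    by_cases hgood : ∀ v ∈ S, (R v).HasL X y ∧ (R v).HasU X y → (long v ↔ e.isLeft)
    · exact ⟨newCell X y d e, fun v hv =>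
        newCell_mem_surgery (fun h => hd1 h v) (he v hv) (hgood v hv)⟩
    -- Some `b` in `S` lost the arm containing `e`. By the choice of `long`, or by `hlong`, every
    -- path through `e` is then in the claw and so has the inserted cell.
    · push Not at hgood
      obtain ⟨b, hbS, hb, hbl⟩ := hgood
      refine ⟨.inl (X, y), fun v hv => (hmem v).2 ?_⟩
      have h1 := he b hbS
      have h2 := he v hv
      rcases e with ⟨i, j⟩ | ⟨i, j⟩
      · have hbv : (R b).HMeet (R v) := by
          simp only [mem_cells_inl] at h1 h2
          unfold HMeet; omega
        have hbl' : ¬ long b := by simpa using hbl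
        by_contra hv'
        exact hbl' ⟨v, hbv, fun h => hv' (Or.inl h), fun h => hv' (Or.inr (Or.inl h))⟩
      · have hbv : (R b).VMeet (R v) := by
          simp only [mem_cells_inr] at h1 h2
          unfold VMeet; omega
        have hbl' : long b := by simpa using hbl
        exact Or.inr (hlong b hb hbl' v hbv)
  · rintro u v ⟨e, he⟩
    have hu := he u (by simp)
    have hv := he v (by simp)
    by_cases hE : e = .inl (X, y)
    · subst hE
      rw [common_pair_iff]
      exact ((hmem u).1 hu).meet ((hmem v).1 hv)
    · refine ⟨oldCell X y d e, ?_⟩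
      rintro w hw
      exact oldCell_mem_of_mem_surgery (fun h => hd1 h w) (he w hw) hE

end family

end Ell

/-! ### Recognising the forbidden induced subgraphs -/

section forbidden
variable {V W : Type*} {G : SimpleGraph V}

lemma not_inducedFree_of_map {H : SimpleGraph W} (f : W → V) (hf : Function.Injective f)
    (h : ∀ i j, G.Adj (f i) (f j) ↔ H.Adj i j) : ¬ InducedFree H G :=
  fun hfree => hfree ⟨⟨⟨f, hf⟩, fun {i j} => h i j⟩⟩

lemma not_inducedFree_of_map_fin {n : ℕ} {H : SimpleGraph (Fin n)} (f : Fin n → V)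
    (hne : ∀ i j, i < j → f i ≠ f j) (h : ∀ i j, i < j → (G.Adj (f i) (f j) ↔ H.Adj i j)) :
    ¬ InducedFree H G := by
  refine not_inducedFree_of_map f ?_ ?_
  · intro i j hij
    rcases lt_trichotomy i j with h' | h' | h'
    · exact absurd hij (hne i j h')
    · exact h'
    · exact absurd hij.symm (hne j i h')
  · intro i j
    rcases lt_trichotomy i j with h' | rfl | h'
    · exact h i j h'
    · simp
    · rw [G.adj_comm, H.adj_comm, h j i h']

lemma no_induced_cycleGraph_four (hC4 : InducedFree (SimpleGraph.cycleGraph 4) G) {a b c d : V}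
    (hab : G.Adj a b) (hbc : G.Adj b c) (hcd : G.Adj c d) (hda : G.Adj d a)
    (hac : ¬ G.Adj a c) (hbd : ¬ G.Adj b d) (hac' : a ≠ c) (hbd' : b ≠ d) : False := by
  refine not_inducedFree_of_map_fin ![a, b, c, d] ?_ ?_ hC4
  · intro i j hij
    fin_cases i <;> fin_cases j <;> first
      | exact absurd hij (by decide)
      | exact hab.ne
      | exact hac'
      | exact hda.ne'
      | exact hbc.ne
      | exact hbd'
      | exact hcd.ne
  · intro i j hij
    simp only [SimpleGraph.cycleGraph_adj]
    fin_cases i <;> fin_cases j <;> first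
      | exact absurd hij (by decide)
      | exact iff_of_true hab (by decide)
      | exact iff_of_false hac (by decide)
      | exact iff_of_true hda.symm (by decide)
      | exact iff_of_true hbc (by decide)
      | exact iff_of_false hbd (by decide)
      | exact iff_of_true hcd (by decide)

/-- A graph on six vertices with the adjacencies common to the three suns is contained in `G` when
its remaining adjacencies agree. -/
lemma not_inducedFree_sun {H : SimpleGraph (Fin 6)} {u v w t tv tw : V}
    (h01 : H.Adj 0 1) (h02 : H.Adj 0 2) (h12 : H.Adj 1 2) (h13 : H.Adj 1 3) (h23 : H.Adj 2 3)
    (h03 : ¬ H.Adj 0 3) (h14 : H.Adj 1 4) (h24 : ¬ H.Adj 2 4) (h25 : H.Adj 2 5)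
    (h15 : ¬ H.Adj 1 5) (h34 : ¬ H.Adj 3 4) (h35 : ¬ H.Adj 3 5) (h45 : ¬ H.Adj 4 5)
    (huv : G.Adj u v) (huw : G.Adj u w) (hvw : G.Adj v w)
    (htv : G.Adj t v) (htw : G.Adj t w) (htu : ¬ G.Adj t u) (htu' : t ≠ u)
    (h1 : G.Adj tv v) (h1' : ¬ G.Adj tv w) (h2 : G.Adj tw w) (h2' : ¬ G.Adj tw v)
    (h3 : ¬ G.Adj t tv) (h4 : ¬ G.Adj t tw) (h5 : ¬ G.Adj tv tw)
    (h04 : G.Adj tv u ↔ H.Adj 0 4) (h05 : G.Adj tw u ↔ H.Adj 0 5) : ¬ InducedFree H G := by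
  refine not_inducedFree_of_map_fin ![u, v, w, t, tv, tw] ?_ ?_
  · have e1 : u ≠ tv := by rintro rfl; exact h1' huw
    have e2 : u ≠ tw := by rintro rfl; exact h2' huv
    have e3 : t ≠ tv := by rintro rfl; exact h1' htw
    have e4 : t ≠ tw := by rintro rfl; exact h2' htv
    have e5 : tv ≠ tw := by rintro rfl; exact h1' h2
    have e6 : w ≠ tv := by rintro rfl; exact h3 htw
    have e7 : v ≠ tw := by rintro rfl; exact h4 htv
    intro i j hij
    fin_cases i <;> fin_cases j <;> first
      | exact absurd hij (by decide)
      | exact huv.ne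
      | exact huw.ne
      | exact htu'.symm
      | exact e1
      | exact e2
      | exact hvw.ne
      | exact htv.ne'
      | exact h1.ne'
      | exact e7
      | exact htw.ne'
      | exact e6
      | exact h2.ne'
      | exact e3
      | exact e4
      | exact e5
  · intro i j hij
    fin_cases i <;> fin_cases j <;> first
      | exact absurd hij (by decide)
      | exact iff_of_true huv h01
      | exact iff_of_true huw h02
      | exact iff_of_false (fun h => htu h.symm) h03
      | exact (G.adj_comm _ _).trans h04
      | exact (G.adj_comm _ _).trans h05
      | exact iff_of_true hvw h12
      | exact iff_of_true htv.symm h13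
      | exact iff_of_true h1.symm h14
      | exact iff_of_false (fun h => h2' h.symm) h15
      | exact iff_of_true htw.symm h23
      | exact iff_of_false (fun h => h1' h.symm) h24
      | exact iff_of_true h2.symm h25
      | exact iff_of_false h3 h34
      | exact iff_of_false h4 h35
      | exact iff_of_false h5 h45

/-- The adjacencies of `tv` and `tw` to `u` are left open; their four possibilities are covered by
the three suns. -/
lemma no_induced_sun (hS3 : InducedFree graphS3 G) (hS3' : InducedFree graphS3' G)
    (hS3'' : InducedFree graphS3'' G) {u v w t tv tw : V}
    (huv : G.Adj u v) (huw : G.Adj u w) (hvw : G.Adj v w)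
    (htv : G.Adj t v) (htw : G.Adj t w) (htu : ¬ G.Adj t u) (htu' : t ≠ u)
    (h1 : G.Adj tv v) (h1' : ¬ G.Adj tv w) (h2 : G.Adj tw w) (h2' : ¬ G.Adj tw v)
    (h3 : ¬ G.Adj t tv) (h4 : ¬ G.Adj t tw) (h5 : ¬ G.Adj tv tw) : False := by
  by_cases ha : G.Adj tv u <;> by_cases hb : G.Adj tw u
  · refine not_inducedFree_sun ?_ ?_ ?_ ?_ ?_ ?_ ?_ ?_ ?_ ?_ ?_ ?_ ?_ huv huw hvw htv htw htu htu'
      h1 h1' h2 h2' h3 h4 h5 (iff_of_true ha ?_) (iff_of_true hb ?_) hS3 <;> simp [graphS3]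
  · refine not_inducedFree_sun ?_ ?_ ?_ ?_ ?_ ?_ ?_ ?_ ?_ ?_ ?_ ?_ ?_ huv huw hvw htv htw htu htu'
      h1 h1' h2 h2' h3 h4 h5 (iff_of_true ha ?_) (iff_of_false hb ?_) hS3' <;> simp [graphS3']
  -- In `graphS3'` vertex `4` is the one joined to `0`, so the roles of `v` and `w` are exchanged.
  · refine not_inducedFree_sun ?_ ?_ ?_ ?_ ?_ ?_ ?_ ?_ ?_ ?_ ?_ ?_ ?_ huw huv hvw.symm htw htv htu
      htu' h2 h2' h1 h1' h4 h3 (fun h => h5 h.symm) (iff_of_true hb ?_) (iff_of_false ha ?_) hS3'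
      <;> simp [graphS3']
  · refine not_inducedFree_sun ?_ ?_ ?_ ?_ ?_ ?_ ?_ ?_ ?_ ?_ ?_ ?_ ?_ huv huw hvw htv htw htu htu'
      h1 h1' h2 h2' h3 h4 h5 (iff_of_false ha ?_) (iff_of_false hb ?_) hS3'' <;> simp [graphS3'']

end forbidden

/-! ### Forbidden configurations around a claw -/

namespace Ell

variable {V : Type*}

section
variable {P Q : Ell} {x y : ℤ}

@[simp] lemma hasL_reflectX : P.reflectX.HasL (-x) y ↔ P.HasR x y := by
  simp only [HasL, HasR, reflectX]; omega
@[simp] lemma hasR_reflectX : P.reflectX.HasR (-x) y ↔ P.HasL x y := by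
  simp only [HasL, HasR, reflectX]; omega
@[simp] lemma hasU_reflectX : P.reflectX.HasU (-x) y ↔ P.HasU x y := by
  simp only [HasU, reflectX]; omega
@[simp] lemma hasD_reflectX : P.reflectX.HasD (-x) y ↔ P.HasD x y := by
  simp only [HasD, reflectX]; omega
@[simp] lemma hMeet_reflectX : P.reflectX.HMeet Q.reflectX ↔ P.HMeet Q := by
  simp only [HMeet, reflectX]; omega
@[simp] lemma vMeet_reflectX : P.reflectX.VMeet Q.reflectX ↔ P.VMeet Q := by
  simp only [VMeet, reflectX]; omega
@[simp] lemma hasL_reflectY : P.reflectY.HasL x (-y) ↔ P.HasL x y := by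
  simp only [HasL, reflectY]; omega
@[simp] lemma hasR_reflectY : P.reflectY.HasR x (-y) ↔ P.HasR x y := by
  simp only [HasR, reflectY]; omega
@[simp] lemma hasU_reflectY : P.reflectY.HasU x (-y) ↔ P.HasD x y := by
  simp only [HasU, HasD, reflectY]; omega

end

section
variable {R : V → Ell} {G : SimpleGraph V}

lemma Represents.adj (h : Represents R G) {u v : V} (hne : u ≠ v) (hm : (R u).Meet (R v)) :
    G.Adj u v := (h u v hne).2 hm

lemma Represents.not_adj (h : Represents R G) {u v : V} (hm : ¬ (R u).Meet (R v)) :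
    ¬ G.Adj u v := fun ha => hm ((h u v ha.ne).1 ha)

/-- The cycle is `a, b, e, f`: consecutive paths share the left, upper, lower and right edge at the
point, and opposite ones do not meet. -/
lemma Represents.not_straight_and_RD (h : Represents R G)
    (hC4 : InducedFree (SimpleGraph.cycleGraph 4) G) {x y : ℤ} {a b e f : V}
    (ha : (R a).HasL x y ∧ (R a).HasR x y) (hb : (R b).HasL x y ∧ (R b).HasU x y)
    (he : (R e).HasU x y ∧ (R e).HasD x y) (hf : (R f).HasR x y ∧ (R f).HasD x y) : False := by
  have hae := not_meet_straight ha he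
  have hbf := not_meet_LU_RD hb hf
  have ha' := not_hasL_hasR_vertical ha.1 ha.2
  have he' := not_hasU_hasD_horizontal he.1 he.2
  refine no_induced_cycleGraph_four hC4 (a := a) (b := b) (c := e) (d := f)
    (h.adj ?_ (Or.inl (hMeet_of_hasL ha.1 hb.1))) (h.adj ?_ (Or.inr (vMeet_of_hasU hb.2 he.1)))
    (h.adj ?_ (Or.inr (vMeet_of_hasD he.2 hf.2))) (h.adj ?_ (Or.inl (hMeet_of_hasR hf.1 ha.2)))
    (h.not_adj hae) (h.not_adj hbf) ?_ ?_
  · rintro rfl; exact ha'.1 hb.2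
  · rintro rfl; exact he'.1 hb.1
  · rintro rfl; exact he'.2 hf.1
  · rintro rfl; exact ha'.2 hf.2
  · rintro rfl; exact ha'.1 he.1
  · rintro rfl; exact hbf (Or.inl (hMeet_of_hasL hb.1 hb.1))

lemma Represents.reflectX (h : Represents R G) : Represents (fun v => (R v).reflectX) G :=
  h.of_common_iff (common_reflectX R)

lemma Represents.not_straight_and_LD (h : Represents R G)
    (hC4 : InducedFree (SimpleGraph.cycleGraph 4) G) {x y : ℤ} {a c e f : V}
    (ha : (R a).HasL x y ∧ (R a).HasR x y) (hc : (R c).HasR x y ∧ (R c).HasU x y)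
    (he : (R e).HasU x y ∧ (R e).HasD x y) (hf : (R f).HasL x y ∧ (R f).HasD x y) : False :=
  h.reflectX.not_straight_and_RD hC4 (x := -x) (y := y) (a := a) (b := c) (e := e) (f := f)
    (by simpa using ha.symm) (by simpa using hc) (by simpa using he) (by simpa using hf)

/-- The cycle is `b, c, f, e`, whose consecutive paths share the upper, right, lower and left edge.
-/
lemma Represents.not_LD_and_RD (h : Represents R G)
    (hC4 : InducedFree (SimpleGraph.cycleGraph 4) G) {x y : ℤ} {b c e f : V}
    (hb : (R b).HasL x y ∧ (R b).HasU x y) (hc : (R c).HasR x y ∧ (R c).HasU x y)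
    (he : (R e).HasL x y ∧ (R e).HasD x y) (hf : (R f).HasR x y ∧ (R f).HasD x y) : False := by
  have hbf := not_meet_LU_RD hb hf
  have hce := not_meet_RU_LD hc he
  refine no_induced_cycleGraph_four hC4 (a := b) (b := c) (c := f) (d := e)
    (h.adj ?_ (Or.inr (vMeet_of_hasU hb.2 hc.2))) (h.adj ?_ (Or.inl (hMeet_of_hasR hc.1 hf.1)))
    (h.adj ?_ (Or.inr (vMeet_of_hasD hf.2 he.2))) (h.adj ?_ (Or.inl (hMeet_of_hasL he.1 hb.1)))
    (h.not_adj hbf) (h.not_adj hce) ?_ ?_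
  · rintro rfl; exact (not_hasL_hasR_vertical hb.1 hc.1).1 hb.2
  · rintro rfl; exact (not_hasU_hasD_horizontal hc.2 hf.2).2 hc.1
  · rintro rfl; exact (not_hasL_hasR_vertical he.1 hf.1).2 hf.2
  · rintro rfl; exact (not_hasU_hasD_horizontal hb.2 he.2).1 hb.1
  · rintro rfl; exact hbf (Or.inl (hMeet_of_hasL hb.1 hb.1))
  · rintro rfl; exact hce (Or.inl (hMeet_of_hasR hc.1 hc.1))

/-- At a claw, either no left-up path or no right-up path has exclusive neighbours on both arms. -/
lemma Represents.no_exclusive_neighbours (h : Represents R G)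
    (hS3 : InducedFree graphS3 G) (hS3' : InducedFree graphS3' G)
    (hS3'' : InducedFree graphS3'' G) (hC4 : InducedFree (SimpleGraph.cycleGraph 4) G)
    {x y : ℤ} {a b c l₁ l₂ t₁ t₂ : V} (ha : (R a).HasL x y ∧ (R a).HasR x y)
    (hb : (R b).HasL x y ∧ (R b).HasU x y) (hc : (R c).HasR x y ∧ (R c).HasU x y)
    (hl₁ : (R b).HMeet (R l₁)) (hl₁a : ¬ ((R l₁).HasL x y ∧ (R l₁).HasR x y))
    (hl₁b : ¬ ((R l₁).HasL x y ∧ (R l₁).HasU x y))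
    (ht₁ : (R b).VMeet (R t₁)) (ht₁b : ¬ ((R t₁).HasL x y ∧ (R t₁).HasU x y))
    (ht₁c : ¬ ((R t₁).HasR x y ∧ (R t₁).HasU x y))
    (hl₂ : (R c).HMeet (R l₂)) (hl₂a : ¬ ((R l₂).HasL x y ∧ (R l₂).HasR x y))
    (hl₂c : ¬ ((R l₂).HasR x y ∧ (R l₂).HasU x y))
    (ht₂ : (R c).VMeet (R t₂)) (ht₂b : ¬ ((R t₂).HasL x y ∧ (R t₂).HasU x y))
    (ht₂c : ¬ ((R t₂).HasR x y ∧ (R t₂).HasU x y)) : False := by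
  -- Both upper arms start at `(x, y)`, so a neighbour on the shorter one meets the longer one too.
  obtain ⟨t, htb, htc, htb', htc'⟩ : ∃ t, (R b).VMeet (R t) ∧ (R c).VMeet (R t) ∧
      ¬ ((R t).HasL x y ∧ (R t).HasU x y) ∧ ¬ ((R t).HasR x y ∧ (R t).HasU x y) := by
    rcases exists_vMeet_both hb.2 hc.2 (p_eq_of_bend (Or.inl hb.1) hb.2)
      (p_eq_of_bend (Or.inr hc.1) hc.2) ht₁ ht₂ with h' | h'
    · exact ⟨t₁, h'.1, h'.2, ht₁b, ht₁c⟩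
    · exact ⟨t₂, h'.1, h'.2, ht₂b, ht₂c⟩
  have hab : a ≠ b := by rintro rfl; exact (not_hasL_hasR_vertical ha.1 ha.2).1 hb.2
  have hac : a ≠ c := by rintro rfl; exact (not_hasL_hasR_vertical ha.1 ha.2).1 hc.2
  have hbc : b ≠ c := by rintro rfl; exact (not_hasL_hasR_vertical hb.1 hc.1).1 hb.2
  have hta : ¬ (R t).Meet (R a) := not_meet_upper ⟨Or.inl hb.1, hb.2⟩ ha htb htb' htc'
  -- The triangle is `a, b, c`; `t` is attached to `b` and `c`, `l₁` to `b`, and `l₂` to `c`.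
  -- Whether `l₁` and `l₂` meet `a` is not controlled, hence three suns.
  refine no_induced_sun hS3 hS3' hS3'' (u := a) (v := b) (w := c) (t := t) (tv := l₁) (tw := l₂)
    (h.adj hab (Or.inl (hMeet_of_hasL ha.1 hb.1))) (h.adj hac (Or.inl (hMeet_of_hasR ha.2 hc.1)))
    (h.adj hbc (Or.inr (vMeet_of_hasU hb.2 hc.2))) (h.adj ?_ (Or.inr htb.symm))
    (h.adj ?_ (Or.inr htc.symm)) (h.not_adj hta) ?_ (h.adj ?_ (Or.inl hl₁.symm))
    (h.not_adj (not_meet_left hb hc hl₁ hl₁a hl₁b)) (h.adj ?_ (Or.inl hl₂.symm))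
    (h.not_adj (not_meet_right hb hc hl₂ hl₂a hl₂c))
    (h.not_adj (not_meet_upper_left hb hl₁ hl₁b htb htb' htc' ?_))
    (h.not_adj (not_meet_upper_right hc hl₂ hl₂c htc htb' htc' ?_))
    (h.not_adj (not_meet_left_right hb hc hl₁ hl₂ hl₁a hl₂a hl₂c ?_))
  · rintro rfl; exact htb' hb
  · rintro rfl; exact htc' hc
  · rintro rfl; exact hta (Or.inl (hMeet_of_hasL ha.1 ha.1))
  · rintro rfl; exact hl₁b hb
  · rintro rfl; exact hl₂c hc
  · exact fun h' => h.not_straight_and_LD hC4 ha hc h'.1 h'.2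
  · exact fun h' => h.not_straight_and_RD hC4 ha hb h'.1 h'.2
  · exact fun h' => h.not_LD_and_RD hC4 hb hc h'.1 h'.2

lemma Represents.improvable_of_hasClaw (h : Represents R G)
    (hS3 : InducedFree graphS3 G) (hS3' : InducedFree graphS3' G)
    (hS3'' : InducedFree graphS3'' G) (hC4 : InducedFree (SimpleGraph.cycleGraph 4) G)
    {x y : ℤ} (hclaw : HasClaw R x y) : Improvable R := by
  obtain ⟨⟨a, ha⟩, ⟨b₀, hb₀⟩, ⟨c₀, hc₀⟩⟩ := id hclaw
  by_cases hlong : ∀ b, (R b).HasL x y ∧ (R b).HasU x y →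
      (∃ l, (R b).HMeet (R l) ∧ ¬ ((R l).HasL x y ∧ (R l).HasR x y) ∧
        ¬ ((R l).HasL x y ∧ (R l).HasU x y)) →
      ∀ t, (R b).VMeet (R t) → ((R t).HasL x y ∧ (R t).HasU x y) ∨
        ((R t).HasR x y ∧ (R t).HasU x y)
  · exact hclaw.improvable
      (fun ⟨⟨e, he⟩, ⟨f, hf⟩⟩ => h.not_straight_and_RD hC4 ha hb₀ he hf)
      (fun ⟨⟨e, he⟩, ⟨f, hf⟩⟩ => h.not_LD_and_RD hC4 hb₀ hc₀ he hf) hlong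
  -- The left-up path `b` is blocked. The mirror image exchanges left-up and right-up, and a blocked
  -- path there would complete a sun with `b`.
  · push Not at hlong
    obtain ⟨b, hb, ⟨l₁, hl₁, hl₁a, hl₁b⟩, t₁, ht₁, ht₁b, ht₁c⟩ := hlong
    refine Improvable.of_common_iff (common_reflectX R) (HasClaw.improvable (X := -x) (y := y)
      ?_ ?_ ?_ ?_)
    · exact ⟨⟨a, by simpa using ha.symm⟩, ⟨c₀, by simpa using hc₀⟩, ⟨b₀, by simpa using hb₀⟩⟩
    · rintro ⟨⟨e, he⟩, ⟨f, hf⟩⟩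
      exact h.not_straight_and_LD hC4 ha hc₀ (by simpa using he) (by simpa using hf)
    · rintro ⟨⟨f, hf⟩, ⟨e, he⟩⟩
      exact h.not_LD_and_RD hC4 hb₀ hc₀ (by simpa using he) (by simpa using hf)
    · simp only [hasL_reflectX, hasR_reflectX, hasU_reflectX, hMeet_reflectX, vMeet_reflectX]
      rintro c hc ⟨l₂, hl₂, hl₂a, hl₂c⟩ t₂ ht₂
      by_contra ht
      rw [not_or] at ht
      exact h.no_exclusive_neighbours hS3 hS3' hS3'' hC4 ha hb hc hl₁ (fun h' => hl₁a h'.1 h'.2)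
        (fun h' => hl₁b h'.1 h'.2) ht₁ (fun h' => ht₁b h'.1 h'.2) (fun h' => ht₁c h'.1 h'.2)
        hl₂ (fun h' => hl₂a h'.symm) hl₂c ht₂ ht.2 ht.1

end

/-! ### From claw-free representations to the Helly property -/

section helly
variable {R : V → Ell}

/-- Helly's theorem for intervals: the cell at the rightmost left end is common. -/
lemma common_of_hMeet [Finite V] {S : Set V} (hS : S.Nonempty)
    (h : ∀ i ∈ S, ∀ j ∈ S, (R i).HMeet (R j)) : Common R S := by
  obtain ⟨m, hm, hmax⟩ := Set.exists_max_image S (fun v => (R v).a) S.toFinite hS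
  refine ⟨.inl ((R m).a, (R m).r), fun v hv => ?_⟩
  have h1 := hmax v hv
  have h2 := h m hm v hv
  rw [mem_cells_inl]
  unfold HMeet at h2
  omega

lemma common_of_vMeet [Finite V] {S : Set V} (hS : S.Nonempty)
    (h : ∀ i ∈ S, ∀ j ∈ S, (R i).VMeet (R j)) : Common R S :=
  (common_transpose R S).1 (common_of_hMeet hS h)

/-- A claw in one of the four orientations. -/
def HasSomeClaw (R : V → Ell) : Prop :=
  ∃ x y, HasClaw R x y ∨ HasClaw (fun v => (R v).reflectY) x y ∨
    HasClaw (fun v => (R v).transpose) x y ∨ HasClaw (fun v => (R v).transpose.reflectY) x y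

/-- Both `j` and `k` lie in the row of `l` and in a common column, so they bend at one corner. Their
horizontal arms point to opposite sides, and `l` meets both, so it passes through the corner. -/
lemma hasSomeClaw_of_hMeet {j k l : V} (hjk : (R j).VMeet (R k)) (hjl : (R j).HMeet (R l))
    (hkl : (R k).HMeet (R l)) (hjk' : ¬ (R j).HMeet (R k)) :
    ∃ x y, HasClaw R x y ∨ HasClaw (fun v => (R v).reflectY) x y := by
  have h1 := (R j).corner
  have h2 := (R k).corner
  unfold HMeet at hjl hkl hjk'
  unfold VMeet at hjk
  obtain ⟨h3, h4⟩ := h1 (by omega) (by omega)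
  obtain ⟨h5, h6⟩ := h2 (by omega) (by omega)
  rcases h4 with h4 | h4
  · refine ⟨(R j).c, (R j).r, Or.inl ⟨⟨l, ?_⟩, ?_⟩⟩
    · unfold HasL HasR; omega
    · rcases h3 with h3 | h3
      · refine ⟨⟨k, ?_⟩, ⟨j, ?_⟩⟩ <;> unfold HasU <;> [unfold HasL; unfold HasR] <;> omega
      · refine ⟨⟨j, ?_⟩, ⟨k, ?_⟩⟩ <;> unfold HasU <;> [unfold HasL; unfold HasR] <;> omega
  · refine ⟨(R j).c, -(R j).r, Or.inr ⟨⟨l, ?_⟩, ?_⟩⟩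
    · simp only [hasL_reflectY, hasR_reflectY]
      unfold HasL HasR; omega
    · simp only [hasL_reflectY, hasR_reflectY, hasU_reflectY]
      rcases h3 with h3 | h3
      · refine ⟨⟨k, ?_⟩, ⟨j, ?_⟩⟩ <;> unfold HasD <;> [unfold HasL; unfold HasR] <;> omega
      · refine ⟨⟨j, ?_⟩, ⟨k, ?_⟩⟩ <;> unfold HasD <;> [unfold HasL; unfold HasR] <;> omega

lemma hasSomeClaw_of_meet {j k l : V} (hjk : (R j).Meet (R k)) (hjl : (R j).Meet (R l))
    (hkl : (R k).Meet (R l)) (hjk' : ¬ (R j).HMeet (R k)) (hjl' : ¬ (R j).VMeet (R l)) :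
    HasSomeClaw R := by
  have h1 : (R j).VMeet (R k) := hjk.resolve_left hjk'
  have h2 : (R j).HMeet (R l) := hjl.resolve_right hjl'
  rcases hkl with h3 | h3
  · obtain ⟨x, y, h | h⟩ := hasSomeClaw_of_hMeet h1 h2 h3 hjk'
    · exact ⟨x, y, Or.inl h⟩
    · exact ⟨x, y, Or.inr (Or.inl h)⟩
  · obtain ⟨x, y, h | h⟩ := hasSomeClaw_of_hMeet (R := fun v => (R v).transpose)
      (j := j) (k := l) (l := k) h2 h1 h3.symm hjl'
    · exact ⟨x, y, Or.inr (Or.inr (Or.inl h))⟩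
    · exact ⟨x, y, Or.inr (Or.inr (Or.inr h))⟩

/-- Horizontal meeting is transitive through a path that also meets both vertically. -/
lemma HMeet.of_same_corner {P Q T : Ell} (h1 : P.HMeet T) (h2 : Q.HMeet T) (h3 : P.VMeet T)
    (h4 : Q.VMeet T) : P.HMeet Q := by
  have h5 := P.corner
  have h6 := Q.corner
  have h7 := T.corner
  unfold HMeet VMeet at *
  omega

/-- Pairwise intersecting paths without a common cell contain a claw. -/
lemma common_or_hasSomeClaw [Finite V] {S : Set V} (hS : S.Nonempty)
    (h : ∀ i ∈ S, ∀ j ∈ S, (R i).Meet (R j)) : Common R S ∨ HasSomeClaw R := by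
  by_cases hH : ∀ i ∈ S, ∀ j ∈ S, (R i).HMeet (R j)
  · exact Or.inl (common_of_hMeet hS hH)
  by_cases hV : ∀ i ∈ S, ∀ j ∈ S, (R i).VMeet (R j)
  · exact Or.inl (common_of_vMeet hS hV)
  right
  push Not at hH hV
  obtain ⟨j, hj, k, hk, hjk⟩ := hH
  obtain ⟨l, hl, m, hm, hlm⟩ := hV
  -- Each case looks for one path with a partner met only vertically and another met only
  -- horizontally.
  by_cases h1 : (R j).VMeet (R l)
  · by_cases h2 : (R j).HMeet (R l)
    · by_cases h3 : (R k).VMeet (R l)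
      · have h4 : ¬ (R k).HMeet (R l) := fun h4 => hjk (h2.of_same_corner h4 h1 h3)
        exact hasSomeClaw_of_meet (h l hl k hk) (h l hl m hm) (h k hk m hm)
          (fun h' => h4 h'.symm) hlm
      · exact hasSomeClaw_of_meet (h k hk j hj) (h k hk l hl) (h j hj l hl)
          (fun h' => hjk h'.symm) h3
    · exact hasSomeClaw_of_meet (h l hl j hj) (h l hl m hm) (h j hj m hm)
          (fun h' => h2 h'.symm) hlm
  · exact hasSomeClaw_of_meet (h j hj k hk) (h j hj l hl) (h k hk l hl) hjk h1

lemma Represents.improvable_of_hasSomeClaw {G : SimpleGraph V} (h : Represents R G)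
    (hS3 : InducedFree graphS3 G) (hS3' : InducedFree graphS3' G)
    (hS3'' : InducedFree graphS3'' G) (hC4 : InducedFree (SimpleGraph.cycleGraph 4) G)
    (hclaw : HasSomeClaw R) : Improvable R := by
  obtain ⟨x, y, hc | hc | hc | hc⟩ := hclaw
  · exact h.improvable_of_hasClaw hS3 hS3' hS3'' hC4 hc
  · have hR := common_reflectY R
    exact ((h.of_common_iff hR).improvable_of_hasClaw hS3 hS3' hS3'' hC4 hc).of_common_iff hR
  · have hR := common_transpose R
    exact ((h.of_common_iff hR).improvable_of_hasClaw hS3 hS3' hS3'' hC4 hc).of_common_iff hR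
  · have hR (S : Set V) := (common_reflectY (fun v => (R v).transpose) S).trans
      (common_transpose R S)
    exact ((h.of_common_iff hR).improvable_of_hasClaw hS3 hS3' hS3'' hC4 hc).of_common_iff hR

/-- Induction on the number of subfamilies without a common cell, which drops with each improvement.
-/
lemma Represents.exists_no_claw [Finite V] {G : SimpleGraph V} (h : Represents R G)
    (hS3 : InducedFree graphS3 G) (hS3' : InducedFree graphS3' G)
    (hS3'' : InducedFree graphS3'' G) (hC4 : InducedFree (SimpleGraph.cycleGraph 4) G) :
    ∃ R' : V → Ell, Represents R' G ∧ ¬ HasSomeClaw R' := by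
  induction hn : {S : Set V | ¬ Common R S}.ncard using Nat.strong_induction_on generalizing R with
  | _ n ih =>
    by_cases hc : HasSomeClaw R
    · obtain ⟨R', h1, h2, S, h3, h4⟩ := h.improvable_of_hasSomeClaw hS3 hS3' hS3'' hC4 hc
      refine ih _ ?_ (R := R') ?_ rfl
      · rw [← hn]
        refine Set.ncard_lt_ncard ⟨fun T hT hT' => hT (h1 T hT'), fun hsub => ?_⟩
          (Set.toFinite _)
        exact hsub h4 h3
      · intro u v huv
        rw [h u v huv, ← common_pair_iff, ← common_pair_iff]
        exact ⟨h1 _, h2 u v⟩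
    · exact ⟨R, h, hc⟩

/-- The cells of the paths of some representation have the Helly property. -/
lemma Represents.exists_helly [Finite V] {G : SimpleGraph V} (h : Represents R G)
    (hS3 : InducedFree graphS3 G) (hS3' : InducedFree graphS3' G)
    (hS3'' : InducedFree graphS3'' G) (hC4 : InducedFree (SimpleGraph.cycleGraph 4) G) :
    ∃ R' : V → Ell, Represents R' G ∧ HellyProperty (fun v => (R' v).cells) := by
  obtain ⟨R', h1, h2⟩ := h.exists_no_claw hS3 hS3' hS3'' hC4
  refine ⟨R', h1, fun S hS hpair => ?_⟩
  refine (common_or_hasSomeClaw hS fun i hi j hj => ?_).resolve_right h2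
  exact (inter_nonempty_iff _ _).1 (hpair i hi j hj)

end helly

end Ell

/-! ### Translation between grid paths and `Ell` -/

lemma gridGraph_adj_iff {p q : ℤ × ℤ} : gridGraph.Adj p q ↔
    (p.2 = q.2 ∧ (q.1 = p.1 + 1 ∨ p.1 = q.1 + 1)) ∨
      (p.1 = q.1 ∧ (q.2 = p.2 + 1 ∨ p.2 = q.2 + 1)) := by
  change |p.1 - q.1| + |p.2 - q.2| = 1 ↔ _
  rcases abs_cases (p.1 - q.1) with h | h <;> rcases abs_cases (p.2 - q.2) with h' | h' <;> omega

lemma bendCount_eq_zero_iff (l : List (ℤ × ℤ)) : bendCount l = 0 ↔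
    ∀ k, (h : k + 2 < l.length) → l[k].1 = l[k + 2].1 ∨ l[k].2 = l[k + 2].2 := by
  induction l with
  | nil => simp [bendCount]
  | cons p l ih =>
    rcases l with _ | ⟨q, _ | ⟨r, l⟩⟩
    · simp [bendCount]
    · simp [bendCount]
    · rw [bendCount, Nat.add_eq_zero_iff, ih]
      constructor
      · rintro ⟨h1, h2⟩ k hk
        rcases k with _ | k
        · by_contra h
          rw [not_or] at h
          exact absurd ((if_pos h).symm.trans h1) one_ne_zero
        · exact h2 k (by simpa using hk)
      · intro h
        refine ⟨if_neg fun h1 => ?_, fun k hk => h (k + 1) (by simpa using hk)⟩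
        exact (h 0 (by simp)).elim h1.1 h1.2

/-- The exceptional index `m` need not be a bend, nor even in range, so straight paths are included.
-/
lemma bendCount_le_one_iff (l : List (ℤ × ℤ)) : bendCount l ≤ 1 ↔
    ∃ m, ∀ k, (h : k + 2 < l.length) → k ≠ m →
      l[k].1 = l[k + 2].1 ∨ l[k].2 = l[k + 2].2 := by
  induction l with
  | nil => simp [bendCount]
  | cons p l ih =>
    rcases l with _ | ⟨q, _ | ⟨r, l⟩⟩
    · simp [bendCount]
    · simp [bendCount]
    · rw [bendCount]
      by_cases hb : p.1 ≠ r.1 ∧ p.2 ≠ r.2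
      · rw [if_pos hb]
        constructor
        · intro h
          have h0 := (bendCount_eq_zero_iff (q :: r :: l)).1 (by omega)
          refine ⟨0, fun k hk hk0 => ?_⟩
          rcases k with _ | k
          · exact absurd rfl hk0
          · exact h0 k (by simpa using hk)
        · rintro ⟨m, hm⟩
          have hm0 : m = 0 := by
            by_contra hm0
            exact (hm 0 (by simp) (Ne.symm hm0)).elim hb.1 hb.2
          have h0 := (bendCount_eq_zero_iff (q :: r :: l)).2
            fun k hk => hm (k + 1) (by simpa using hk) (by omega)
          omega
      · rw [if_neg hb, zero_add, ih]
        constructor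
        · rintro ⟨m, hm⟩
          refine ⟨m + 1, fun k hk hkm => ?_⟩
          rcases k with _ | k
          · simpa [or_iff_not_imp_left] using hb
          · exact hm k (by simpa using hk) (by omega)
        · rintro ⟨m, hm⟩
          rcases m with _ | m
          · exact ⟨0, fun k hk _ => hm (k + 1) (by simpa using hk) (by omega)⟩
          · exact ⟨m, fun k hk hkm => hm (k + 1) (by simpa using hk) (by omega)⟩

lemma GridPath.bends_le_one_iff (P : GridPath) : P.bends ≤ 1 ↔
    ∃ m, ∀ k, k + 2 ≤ P.walk.length → k ≠ m →
      (P.walk.getVert k).1 = (P.walk.getVert (k + 2)).1 ∨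
        (P.walk.getVert k).2 = (P.walk.getVert (k + 2)).2 := by
  rw [GridPath.bends, bendCount_le_one_iff]
  refine exists_congr fun m => forall_congr' fun k => ?_
  simp only [SimpleGraph.Walk.length_support, SimpleGraph.Walk.support_getElem_eq_getVert]
  exact ⟨fun h hk => h (by omega), fun h hk => h (by omega)⟩

/-- The edges of a sequence of `n` steps. -/
def stepEdges (f : ℕ → ℤ × ℤ) (n : ℕ) : Set (Sym2 (ℤ × ℤ)) := {e | ∃ k < n, e = s(f k, f (k + 1))}

lemma stepEdges_add (f : ℕ → ℤ × ℤ) (m n : ℕ) :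
    stepEdges f (m + n) = stepEdges f m ∪ stepEdges (fun k => f (m + k)) n := by
  ext e
  constructor
  · rintro ⟨k, hk, rfl⟩
    rcases lt_or_ge k m with h | h
    · exact Or.inl ⟨k, h, rfl⟩
    · obtain ⟨i, rfl⟩ := Nat.exists_eq_add_of_le h
      exact Or.inr ⟨i, by omega, rfl⟩
  · rintro (⟨k, hk, rfl⟩ | ⟨k, hk, rfl⟩)
    · exact ⟨k, by omega, rfl⟩
    · exact ⟨m + k, by omega, rfl⟩

lemma GridPath.edges_eq_stepEdges (P : GridPath) :
    P.edges = stepEdges P.walk.getVert P.walk.length := by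
  ext e
  induction e with
  | _ u v =>
    rw [GridPath.edges, Set.mem_ofPred_eq, SimpleGraph.Walk.mk_mem_edges_iff_exists]
    constructor
    · rintro ⟨k, hk, h⟩
      exact ⟨k, hk, h.symm⟩
    · rintro ⟨k, hk, h⟩
      exact ⟨k, hk, h.symm⟩

namespace Ell

/-- The grid edge at a cell. -/
def gridEdge : (ℤ × ℤ) ⊕ (ℤ × ℤ) → Sym2 (ℤ × ℤ)
  | .inl (i, j) => s((i, j), (i + 1, j))
  | .inr (i, j) => s((i, j), (i, j + 1))

lemma gridEdge_injective : Function.Injective gridEdge := by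
  rintro (⟨i, j⟩ | ⟨i, j⟩) (⟨i', j'⟩ | ⟨i', j'⟩) h <;>
    simp only [gridEdge, Sym2.eq_iff, Prod.mk.injEq] at h <;>
    simp only [Sum.inl.injEq, Sum.inr.injEq, Prod.mk.injEq, reduceCtorEq] <;> omega

/-- The cells of the row `r` from `a` to `b`. -/
def hseg (r a b : ℤ) : Set ((ℤ × ℤ) ⊕ (ℤ × ℤ)) := {e | ∃ i, a ≤ i ∧ i < b ∧ e = .inl (i, r)}

/-- The cells of the column `c` from `p` to `q`. -/
def vseg (c p q : ℤ) : Set ((ℤ × ℤ) ⊕ (ℤ × ℤ)) := {e | ∃ j, p ≤ j ∧ j < q ∧ e = .inr (c, j)}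

lemma cells_eq (P : Ell) : P.cells = hseg P.r P.a P.b ∪ vseg P.c P.p P.q := by
  ext (⟨i, j⟩ | ⟨i, j⟩)
  · simp [hseg, vseg]; grind
  · simp [hseg, vseg]; grind

lemma hseg_eq_empty {r a b : ℤ} (h : b ≤ a) : hseg r a b = ∅ := by
  ext e
  simp only [hseg, Set.mem_ofPred_eq, Set.mem_empty_iff_false, iff_false]
  rintro ⟨i, h1, h2, -⟩
  omega

lemma vseg_eq_empty {c p q : ℤ} (h : q ≤ p) : vseg c p q = ∅ := by
  ext e
  simp only [vseg, Set.mem_ofPred_eq, Set.mem_empty_iff_false, iff_false]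
  rintro ⟨i, h1, h2, -⟩
  omega

lemma stepEdges_right {f : ℕ → ℤ × ℤ} {n : ℕ} {x y : ℤ} (h : ∀ k ≤ n, f k = (x + k, y)) :
    stepEdges f n = gridEdge '' hseg y x (x + n) := by
  ext e
  constructor
  · rintro ⟨k, hk, rfl⟩
    refine ⟨.inl (x + k, y), ⟨x + k, by omega, by omega, rfl⟩, ?_⟩
    rw [h k hk.le, h (k + 1) hk, gridEdge, Nat.cast_succ, add_assoc]
  · rintro ⟨_, ⟨i, h1, h2, rfl⟩, rfl⟩
    obtain ⟨k, rfl⟩ : ∃ k : ℕ, i = x + k := ⟨(i - x).toNat, by omega⟩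
    have hk : k < n := by omega
    refine ⟨k, hk, ?_⟩
    rw [h k hk.le, h (k + 1) hk, gridEdge, Nat.cast_succ, add_assoc]

lemma stepEdges_up {f : ℕ → ℤ × ℤ} {n : ℕ} {x y : ℤ} (h : ∀ k ≤ n, f k = (x, y + k)) :
    stepEdges f n = gridEdge '' vseg x y (y + n) := by
  ext e
  constructor
  · rintro ⟨k, hk, rfl⟩
    refine ⟨.inr (x, y + k), ⟨y + k, by omega, by omega, rfl⟩, ?_⟩
    rw [h k hk.le, h (k + 1) hk, gridEdge, Nat.cast_succ, add_assoc]
  · rintro ⟨_, ⟨i, h1, h2, rfl⟩, rfl⟩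
    obtain ⟨k, rfl⟩ : ∃ k : ℕ, i = y + k := ⟨(i - y).toNat, by omega⟩
    have hk : k < n := by omega
    refine ⟨k, hk, ?_⟩
    rw [h k hk.le, h (k + 1) hk, gridEdge, Nat.cast_succ, add_assoc]

lemma stepEdges_reverse (f : ℕ → ℤ × ℤ) (n : ℕ) :
    stepEdges (fun k => f (n - k)) n = stepEdges f n := by
  ext e
  constructor
  · rintro ⟨k, hk, rfl⟩
    refine ⟨n - k - 1, by omega, ?_⟩
    rw [Sym2.eq_swap, Nat.sub_sub, show n - (k + 1) + 1 = n - k by omega]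
  · rintro ⟨k, hk, rfl⟩
    refine ⟨n - k - 1, by omega, ?_⟩
    dsimp only
    rw [Sym2.eq_swap, show n - (n - k - 1) = k + 1 by omega,
      show n - (n - k - 1 + 1) = k by omega]

lemma stepEdges_left {f : ℕ → ℤ × ℤ} {n : ℕ} {x y : ℤ} (h : ∀ k ≤ n, f k = (x - k, y)) :
    stepEdges f n = gridEdge '' hseg y (x - n) x := by
  rw [← stepEdges_reverse, stepEdges_right (x := x - n) (y := y), sub_add_cancel]
  intro k hk
  rw [h _ (Nat.sub_le n k), Nat.cast_sub hk, sub_sub_eq_add_sub, add_sub_right_comm]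

lemma stepEdges_down {f : ℕ → ℤ × ℤ} {n : ℕ} {x y : ℤ} (h : ∀ k ≤ n, f k = (x, y - k)) :
    stepEdges f n = gridEdge '' vseg x (y - n) y := by
  rw [← stepEdges_reverse, stepEdges_up (x := x) (y := y - n), sub_add_cancel]
  intro k hk
  rw [h _ (Nat.sub_le n k), Nat.cast_sub hk, sub_sub_eq_add_sub, add_sub_right_comm]

/-- A sequence of steps without turns is a segment. -/
lemma straight_steps {f : ℕ → ℤ × ℤ} {n : ℕ} (hadj : ∀ k < n, gridGraph.Adj (f k) (f (k + 1)))
    (hne : ∀ k, k + 2 ≤ n → f k ≠ f (k + 2))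
    (hst : ∀ k, k + 2 ≤ n → (f k).1 = (f (k + 2)).1 ∨ (f k).2 = (f (k + 2)).2) :
    (∀ k ≤ n, f k = ((f 0).1 + k, (f 0).2)) ∨ (∀ k ≤ n, f k = ((f 0).1 - k, (f 0).2)) ∨
      (∀ k ≤ n, f k = ((f 0).1, (f 0).2 + k)) ∨ (∀ k ≤ n, f k = ((f 0).1, (f 0).2 - k)) := by
  simp only [gridGraph_adj_iff] at hadj
  simp only [ne_eq, Prod.ext_iff] at hne ⊢
  rcases Nat.eq_zero_or_pos n with rfl | hn
  · left
    intro k hk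
    obtain rfl : k = 0 := by omega
    simp
  -- The direction `(a, b)` of the first step propagates: `hst` forbids turning and `hne` forbids
  -- going back.
  have key : ∀ a b : ℤ, (f 1).1 = (f 0).1 + a → (f 1).2 = (f 0).2 + b →
      ∀ k, k + 1 ≤ n → ((f (k + 1)).1 = (f k).1 + a ∧ (f (k + 1)).2 = (f k).2 + b) := by
    intro a b ha hb k
    induction k with
    | zero => exact fun _ => ⟨ha, hb⟩
    | succ k ih =>
      intro hk
      have h1 := ih (by omega)
      have h2 := hadj k (by omega)
      have h3 := hadj (k + 1) (by omega)
      have h4 := hne k (by omega)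
      have h5 := hst k (by omega)
      rw [show k + 1 + 1 = k + 2 from rfl] at h3 ⊢
      omega
  have key2 : ∀ a b : ℤ, (f 1).1 = (f 0).1 + a → (f 1).2 = (f 0).2 + b →
      ∀ k : ℕ, k ≤ n → ((f k).1 = (f 0).1 + k * a ∧ (f k).2 = (f 0).2 + k * b) := by
    intro a b ha hb k
    induction k with
    | zero => simp
    | succ k ih =>
      intro hk
      have h1 := ih (by omega)
      have h2 := key a b ha hb k hk
      push_cast
      constructor <;> linarith
  rcases hadj 0 hn with ⟨h1, h2 | h2⟩ | ⟨h1, h2 | h2⟩ <;> rw [zero_add] at h1 h2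
  · exact Or.inl fun k hk => by
      have := key2 1 0 (by omega) (by omega) k hk
      simpa using this
  · refine Or.inr (Or.inl fun k hk => ?_)
    have := key2 (-1) 0 (by omega) (by omega) k hk
    omega
  · refine Or.inr (Or.inr (Or.inl fun k hk => ?_))
    have := key2 0 1 (by omega) (by omega) k hk
    omega
  · refine Or.inr (Or.inr (Or.inr fun k hk => ?_))
    have := key2 0 (-1) (by omega) (by omega) k hk
    omega

lemma stepEdges_straight {f : ℕ → ℤ × ℤ} {n : ℕ} (hn : 1 ≤ n)
    (hadj : ∀ k < n, gridGraph.Adj (f k) (f (k + 1)))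
    (hne : ∀ k, k + 2 ≤ n → f k ≠ f (k + 2))
    (hst : ∀ k, k + 2 ≤ n → (f k).1 = (f (k + 2)).1 ∨ (f k).2 = (f (k + 2)).2) :
    (∃ a b, a < b ∧ ((a = (f 0).1 ∧ b = (f n).1) ∨ (a = (f n).1 ∧ b = (f 0).1)) ∧
      (∀ k ≤ n, (f k).2 = (f 0).2) ∧ stepEdges f n = gridEdge '' hseg (f 0).2 a b) ∨
    ∃ p q, p < q ∧ ((p = (f 0).2 ∧ q = (f n).2) ∨ (p = (f n).2 ∧ q = (f 0).2)) ∧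
      (∀ k ≤ n, (f k).1 = (f 0).1) ∧ stepEdges f n = gridEdge '' vseg (f 0).1 p q := by
  rcases straight_steps hadj hne hst with h | h | h | h
  · refine Or.inl ⟨_, _, ?_, Or.inl ⟨rfl, ?_⟩, fun k hk => by rw [h k hk], stepEdges_right h⟩
    · omega
    · rw [h n le_rfl]
  · refine Or.inl ⟨_, _, ?_, Or.inr ⟨?_, rfl⟩, fun k hk => by rw [h k hk], stepEdges_left h⟩
    · omega
    · rw [h n le_rfl]
  · refine Or.inr ⟨_, _, ?_, Or.inl ⟨rfl, ?_⟩, fun k hk => by rw [h k hk], stepEdges_up h⟩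
    · omega
    · rw [h n le_rfl]
  · refine Or.inr ⟨_, _, ?_, Or.inr ⟨?_, rfl⟩, fun k hk => by rw [h k hk], stepEdges_down h⟩
    · omega
    · rw [h n le_rfl]

/-- The horizontal segment of the row `r` from `a` to `b`, as a path. -/
lemma exists_cells_eq_hseg {r a b : ℤ} (h : a < b) : ∃ Q : Ell, Q.cells = hseg r a b :=
  ⟨horizontal r a b h, by rw [cells_eq]; simp [horizontal, vseg_eq_empty]⟩

/-- The vertical segment of the column `c` from `p` to `q`, as a path. -/
lemma exists_cells_eq_vseg {c p q : ℤ} (h : p < q) : ∃ Q : Ell, Q.cells = vseg c p q :=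
  ⟨⟨p, c, c, c, p, q, Or.inr h, fun h => absurd h (lt_irrefl c)⟩, by
    rw [cells_eq]; simp [hseg_eq_empty]⟩

/-- A grid path with at most one bend has the edges of an `Ell`. -/
lemma exists_of_gridPath (P : GridPath) (hP : P.bends ≤ 1) :
    ∃ Q : Ell, P.edges = gridEdge '' Q.cells := by
  obtain ⟨m, hm⟩ := P.bends_le_one_iff.1 hP
  have hn := P.one_le_length
  rw [P.edges_eq_stepEdges]
  have hadj : ∀ k < P.walk.length,
      gridGraph.Adj (P.walk.getVert k) (P.walk.getVert (k + 1)) :=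
    fun k hk => P.walk.adj_getVert_succ hk
  have hne : ∀ k, k + 2 ≤ P.walk.length → P.walk.getVert k ≠ P.walk.getVert (k + 2) := by
    intro k hk h
    have := P.isPath.getVert_injOn (by simp; omega) (by simp; omega) h
    omega
  generalize P.walk.getVert = f at *
  generalize P.walk.length = n at *
  by_cases hb : m + 2 ≤ n ∧ ¬ ((f m).1 = (f (m + 2)).1 ∨ (f m).2 = (f (m + 2)).2)
  · obtain ⟨hmn, hb⟩ := hb
    -- The corner of the turn at `m, m + 1, m + 2` is the point with index `m + 1`; the steps before
    -- and after it form straight pieces.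
    obtain ⟨l, rfl⟩ : ∃ l, n = (m + 1) + l := Nat.exists_eq_add_of_le (by omega)
    have hA := stepEdges_straight (f := f) (n := m + 1) (by omega)
      (fun k hk => hadj k (by omega)) (fun k hk => hne k (by omega))
      (fun k hk => hm k (by omega) (by omega))
    have hB := stepEdges_straight (f := fun k => f (m + 1 + k)) (n := l) (by omega)
      (fun k hk => hadj (m + 1 + k) (by omega)) (fun k hk => hne (m + 1 + k) (by omega))
      (fun k hk => hm (m + 1 + k) (by omega) (by omega))
    rw [stepEdges_add]
    rw [add_zero] at hB
    rcases hA with ⟨a, b, h1, h2, h3, h4⟩ | ⟨p, q, h1, h2, h3, h4⟩ <;>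
      rcases hB with ⟨a', b', h1', h2', h3', h4'⟩ | ⟨p', q', h1', h2', h3', h4'⟩
    · exact absurd (Or.inr ((h3 m (by omega)).trans ((h3 (m + 1) le_rfl).symm.trans
        (h3' 1 (by omega)).symm))) hb
    · have h5 := h3 (m + 1) le_rfl
      refine ⟨⟨(f (m + 1)).2, a, b, (f (m + 1)).1, p', q', Or.inl h1, fun _ _ => ?_⟩, ?_⟩
      · omega
      · rw [h4, h4', cells_eq, Set.image_union, ← h5]
    · have h5 := h3 (m + 1) le_rfl
      refine ⟨⟨(f (m + 1)).2, a', b', (f (m + 1)).1, p, q, Or.inl h1', fun _ _ => ?_⟩, ?_⟩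
      · omega
      · rw [h4, h4', cells_eq, Set.image_union, ← h5, Set.union_comm]
    · exact absurd (Or.inl ((h3 m (by omega)).trans ((h3 (m + 1) le_rfl).symm.trans
        (h3' 1 (by omega)).symm))) hb
  · have hst : ∀ k, k + 2 ≤ n → (f k).1 = (f (k + 2)).1 ∨ (f k).2 = (f (k + 2)).2 := by
      intro k hk
      by_cases hkm : k = m
      · subst hkm
        by_contra h
        exact hb ⟨hk, h⟩
      · exact hm k hk hkm
    rcases stepEdges_straight hn hadj hne hst with ⟨a, b, h1, -, -, h4⟩ | ⟨p, q, h1, -, -, h4⟩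
    · obtain ⟨Q, hQ⟩ := exists_cells_eq_hseg (r := (f 0).2) h1
      exact ⟨Q, by rw [h4, hQ]⟩
    · obtain ⟨Q, hQ⟩ := exists_cells_eq_vseg (c := (f 0).1) h1
      exact ⟨Q, by rw [h4, hQ]⟩

lemma exists_walk {W : Type*} {G : SimpleGraph W} (n : ℕ) (f : ℕ → W)
    (hadj : ∀ k < n, G.Adj (f k) (f (k + 1))) :
    ∃ w : G.Walk (f 0) (f n), w.length = n ∧ ∀ k ≤ n, w.getVert k = f k := by
  induction n generalizing f with
  | zero =>
    refine ⟨.nil, rfl, fun k hk => ?_⟩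
    obtain rfl : k = 0 := by omega
    rfl
  | succ n ih =>
    obtain ⟨w, h1, h2⟩ := ih (fun k => f (k + 1)) fun k hk => hadj (k + 1) (by omega)
    refine ⟨.cons (hadj 0 (by omega)) w, by simp [h1], fun k hk => ?_⟩
    rcases k with _ | k
    · rfl
    · rw [SimpleGraph.Walk.getVert_cons_succ]
      exact h2 k (by omega)

lemma exists_gridPath_of_steps {n : ℕ} {f : ℕ → ℤ × ℤ} (hn : 1 ≤ n)
    (hadj : ∀ k < n, gridGraph.Adj (f k) (f (k + 1)))
    (hinj : ∀ k l, k < l → l ≤ n → f k ≠ f l)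
    (hbend : ∃ m, ∀ k, k + 2 ≤ n → k ≠ m → (f k).1 = (f (k + 2)).1 ∨ (f k).2 = (f (k + 2)).2) :
    ∃ P : GridPath, P.bends ≤ 1 ∧ P.edges = stepEdges f n := by
  obtain ⟨w, h1, h2⟩ := exists_walk n f hadj
  have hpath : w.IsPath := by
    rw [← SimpleGraph.Walk.IsPath.getVert_injOn_iff]
    intro k hk l hl hkl
    simp only [h1, Set.mem_ofPred_eq] at hk hl
    rw [h2 k hk, h2 l hl] at hkl
    rcases lt_trichotomy k l with h | h | h
    · exact absurd hkl (hinj k l h hl)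
    · exact h
    · exact absurd hkl.symm (hinj l k h hk)
  refine ⟨⟨_, _, w, hpath, by omega⟩, ?_, ?_⟩
  · rw [GridPath.bends_le_one_iff]
    obtain ⟨m, hm⟩ := hbend
    refine ⟨m, fun k hk hkm => ?_⟩
    dsimp only at hk ⊢
    rw [h2 k (by omega), h2 (k + 2) (by omega)]
    exact hm k (by omega) hkm
  · rw [GridPath.edges_eq_stepEdges]
    ext e
    simp only [stepEdges, Set.mem_ofPred_eq, h1]
    refine exists_congr fun k => and_congr_right fun hk => ?_
    rw [h2 k hk.le, h2 (k + 1) hk]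

/-- The sequence of grid points that comes along a row to the corner `(c, r)` in `m` steps of
direction `s` and continues along the column in direction `t`. -/
def bentSteps (c r s t : ℤ) (m k : ℕ) : ℤ × ℤ :=
  if k ≤ m then (c - s * (m - k), r) else (c, r + t * (k - m))

lemma exists_gridPath_bent (c r : ℤ) {s t : ℤ} (hs : s = 1 ∨ s = -1) (ht : t = 1 ∨ t = -1)
    {m n : ℕ} (hmn : 1 ≤ m + n) : ∃ P : GridPath, P.bends ≤ 1 ∧ P.edges =
      stepEdges (fun k => (c - s * (m - k), r)) m ∪ stepEdges (fun k => (c, r + t * k)) n := by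
  have hadj : ∀ k < m + n, gridGraph.Adj (bentSteps c r s t m k) (bentSteps c r s t m (k + 1)) := by
    intro k hk
    rw [gridGraph_adj_iff]
    unfold bentSteps
    rcases hs with rfl | rfl <;> rcases ht with rfl | rfl <;> split_ifs <;> push_cast <;>
      omega
  have hinj : ∀ k l, k < l → l ≤ m + n → bentSteps c r s t m k ≠ bentSteps c r s t m l := by
    intro k l hkl hl
    unfold bentSteps
    rw [ne_eq, Prod.ext_iff]
    rcases hs with rfl | rfl <;> rcases ht with rfl | rfl <;> split_ifs <;>
      dsimp only <;> omega
  -- The corner has index `m`, so the turn is seen from `m - 1`. For `m = 0` the subtraction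
  -- truncates and the exception is harmless.
  have hbend : ∀ k, k + 2 ≤ m + n → k ≠ m - 1 →
      (bentSteps c r s t m k).1 = (bentSteps c r s t m (k + 2)).1 ∨
        (bentSteps c r s t m k).2 = (bentSteps c r s t m (k + 2)).2 := by
    intro k hk hkm
    unfold bentSteps
    split_ifs
    · right; rfl
    · obtain rfl : k = m := by omega
      left
      rw [sub_self, mul_zero, sub_zero]
    · omega
    · left; rfl
  obtain ⟨P, h1, h2⟩ := exists_gridPath_of_steps hmn hadj hinj ⟨_, hbend⟩
  refine ⟨P, h1, ?_⟩
  rw [h2, stepEdges_add]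
  congr 1
  · ext e
    refine exists_congr fun k => and_congr_right fun hk => ?_
    rw [bentSteps, if_pos hk.le, bentSteps, if_pos (Nat.succ_le_of_lt hk)]
  · have h3 (k : ℕ) : bentSteps c r s t m (m + k) = (c, r + t * k) := by
      unfold bentSteps
      rcases Nat.eq_zero_or_pos k with rfl | hk
      · simp
      · rw [if_neg (by omega)]
        push_cast
        rw [add_sub_cancel_left]
    simp only [h3]

/-- The edges of an `Ell` are those of a grid path with at most one bend. -/
lemma exists_gridPath (Q : Ell) : ∃ P : GridPath, P.bends ≤ 1 ∧ P.edges = gridEdge '' Q.cells := by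
  obtain ⟨c, r, s, t, m, n, hs, ht, hmn, hh, hv⟩ : ∃ c r s t : ℤ, ∃ m n : ℕ,
      (s = 1 ∨ s = -1) ∧ (t = 1 ∨ t = -1) ∧ 1 ≤ m + n ∧
      stepEdges (fun k => (c - s * (m - k), r)) m = gridEdge '' hseg Q.r Q.a Q.b ∧
      stepEdges (fun k => (c, r + t * k)) n = gridEdge '' vseg Q.c Q.p Q.q := by
    have hR (c r : ℤ) (m : ℕ) : stepEdges (fun k => (c - 1 * ((m : ℤ) - k), r)) m =
        gridEdge '' hseg r (c - m) c := by
      rw [stepEdges_right (x := c - m) (y := r), sub_add_cancel]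
      intro k hk
      rw [Prod.mk.injEq]; omega
    have hL (c r : ℤ) (m : ℕ) : stepEdges (fun k => (c - -1 * ((m : ℤ) - k), r)) m =
        gridEdge '' hseg r c (c + m) := by
      rw [stepEdges_left (x := c + m) (y := r), add_sub_cancel_right]
      intro k hk
      rw [Prod.mk.injEq]; omega
    have hU (c r : ℤ) (n : ℕ) : stepEdges (fun k => (c, r + 1 * (k : ℤ))) n =
        gridEdge '' vseg c r (r + n) :=
      stepEdges_up fun k hk => by rw [one_mul]
    have hD (c r : ℤ) (n : ℕ) : stepEdges (fun k => (c, r + -1 * (k : ℤ))) n =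
        gridEdge '' vseg c (r - n) r :=
      stepEdges_down fun k hk => by rw [neg_one_mul, ← sub_eq_add_neg]
    have hzero (f : ℕ → ℤ × ℤ) : stepEdges f 0 = ∅ := by simp [stepEdges]
    have hm (a b : ℤ) (h : a < b) : ∃ m : ℕ, 1 ≤ m ∧ (m : ℤ) = b - a :=
      ⟨(b - a).toNat, by omega, by omega⟩
    by_cases hab : Q.a < Q.b
    · obtain ⟨m, hm1, hm⟩ := hm _ _ hab
      by_cases hpq : Q.p < Q.q
      · obtain ⟨n, hn1, hn⟩ := ‹∀ a b : ℤ, a < b → _› _ _ hpq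
        obtain ⟨hc, hr⟩ := Q.corner hab hpq
        have h1 : ∃ s : ℤ, (s = 1 ∨ s = -1) ∧
            stepEdges (fun k => (Q.c - s * (m - k), Q.r)) m = gridEdge '' hseg Q.r Q.a Q.b := by
          rcases hc with hc | hc
          · exact ⟨-1, Or.inr rfl, by rw [hL, hm, hc, add_sub_cancel]⟩
          · exact ⟨1, Or.inl rfl, by rw [hR, hm, hc, sub_sub_cancel]⟩
        have h2 : ∃ t : ℤ, (t = 1 ∨ t = -1) ∧
            stepEdges (fun k => (Q.c, Q.r + t * k)) n = gridEdge '' vseg Q.c Q.p Q.q := by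
          rcases hr with hr | hr
          · exact ⟨1, Or.inl rfl, by rw [hU, hn, hr, add_sub_cancel]⟩
          · exact ⟨-1, Or.inr rfl, by rw [hD, hn, hr, sub_sub_cancel]⟩
        obtain ⟨s, hs, hs'⟩ := h1
        obtain ⟨t, ht, ht'⟩ := h2
        exact ⟨Q.c, Q.r, s, t, m, n, hs, ht, by omega, hs', ht'⟩
      -- Without a vertical part `Q.c` is arbitrary, so the right end serves as the corner.
      · refine ⟨Q.b, Q.r, 1, 1, m, 0, Or.inl rfl, Or.inl rfl, by omega, ?_, ?_⟩
        · rw [hR, hm, sub_sub_cancel]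
        · rw [hzero, vseg_eq_empty (not_lt.1 hpq), Set.image_empty]
    · obtain ⟨n, hn1, hn⟩ := hm _ _ (Q.nonempty.resolve_left hab)
      refine ⟨Q.c, Q.p, 1, 1, 0, n, Or.inl rfl, Or.inl rfl, by omega, ?_, ?_⟩
      · rw [hzero, hseg_eq_empty (not_lt.1 hab), Set.image_empty]
      · rw [hU, hn, add_sub_cancel]
  obtain ⟨P, h1, h2⟩ := exists_gridPath_bent c r hs ht hmn
  exact ⟨P, h1, by rw [h2, hh, hv, cells_eq, Set.image_union]⟩

end Ell

/-! ### The theorem -/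

lemma HellyProperty.image {ι α β : Type*} {F : ι → Set α} (h : HellyProperty F) {g : α → β}
    (hg : Function.Injective g) : HellyProperty (fun i => g '' F i) := by
  intro S hS hpair
  obtain ⟨a, ha⟩ := h S hS fun i hi j hj => by
    have := hpair i hi j hj
    rw [← Set.image_inter hg] at this
    exact this.of_image
  exact ⟨g a, fun i hi => ⟨a, ha i hi, rfl⟩⟩

theorem mainTheorem4 {V : Type*} [Finite V] (G : SimpleGraph V)
    (hG : IsBendEPG 1 G)
    (hS3 : InducedFree graphS3 G)
    (hS3' : InducedFree graphS3' G)
    (hS3'' : InducedFree graphS3'' G)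
    (hC4 : InducedFree (SimpleGraph.cycleGraph 4) G) :
    IsHellyBendEPG 1 G := by
  obtain ⟨P, hP, hbend⟩ := hG
  choose R hR using fun v => Ell.exists_of_gridPath (P v) (hbend v)
  have hRG : Ell.Represents R G := fun u v huv => by
    rw [hP u v huv, hR, hR, ← Set.image_inter Ell.gridEdge_injective, Set.image_nonempty,
      Ell.inter_nonempty_iff]
  obtain ⟨R', hR'G, hHelly⟩ := hRG.exists_helly hS3 hS3' hS3'' hC4
  choose P' hbend' hP' using fun v => Ell.exists_gridPath (R' v)
  refine ⟨P', ⟨fun u v huv => ?_, hbend'⟩, ?_⟩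
  · rw [hR'G u v huv, hP', hP', ← Set.image_inter Ell.gridEdge_injective, Set.image_nonempty,
      Ell.inter_nonempty_iff]
  · simp only [hP']
    exact hHelly.image Ell.gridEdge_injective
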